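/- Let $k>0$, $h>0$, $n_{cl}>0$, and let $n_{co}:[-h,h]\to[0,\infty)$ be bounded, measurable and even. Let $n(x)=n_{co}(x)$ for $|x|\le h$ and $n(x)=n_{cl}$ for $|x|>h$ (a rectilinear open waveguide), and put $$n_*=\sup_{\mathbb R} n,\quad q(x)=k^2(n_*^2-n(x)^2),\quad d^2=k^2(n_*^2-n_{cl}^2).$$ For $j\in\{s,a\}$ and $\lambda>0$ let $\phi_j(\cdot,\lambda)$ be the (Carathéodory) solution of $\phi''+[\lambda-q(x)]\phi=0$ on $[-h,h]$ with $\phi_s(0,\lambda)=1$, $\phi_s'(0,\lambda)=0$ and $\phi_a(0,\lambda)=0$, $\phi_a'(0,\lambda)=\sqrt\lambda$. Let $\Lambda_j$ be the set of $\lambda\in(0,d^2)$ with $\sqrt{d^2-\lambda}\,\phi_j(h,\lambda)+\phi_j'(h,\lambda)=0$. Let $v_j(x,\lambda)=\phi_j(x,\lambda)$ for $|x|\le h$; for $\lambda>d^2$ and $\pm x>h$ let $$v_j(x,\lambda)=\phi_j(\pm h,\lambda)\cos Q(x\mp h)+\frac{\phi_j'(\pm h,\lambda)}{Q}\sin Q(x\mp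 h),\qquad Q=\sqrt{\lambda-d^2};$$ for $\lambda\in\Lambda_j$ and $\pm x>h$ let $v_j(x,\lambda)=\phi_j(\pm h,\lambda)e^{-\sqrt{d^2-\lambda}\,(|x|-h)}$. For $\lambda\in\Lambda_j$ let $r_j(\lambda)=\big[\int_{\mathbb R}v_j(x,\lambda)^2dx\big]^{-1}$, and for $\lambda>d^2$ let $$\sigma_j(\lambda)=\frac{\sqrt{\lambda-d^2}}{(\lambda-d^2)\phi_j(h,\lambda)^2+\phi_j'(h,\lambda)^2}.$$ Let $\rho_j$ be the measure $\sum_{\lambda\in\Lambda_j}r_j(\lambda)\delta_\lambda+\frac1{2\pi}\sigma_j(\lambda)\mathbf 1_{(d^2,\infty)}(\lambda)\,d\lambda$, and define the Green's function $$G(x,z;\xi,\zeta)=\sum_{j\in\{s,a\}}\int\frac{e^{i|z-\zeta|\sqrt{k^2n_*^2-\lambda}}}{2i\sqrt{k^2n_*^2-\lambda}}\,v_j(x,\lambda)v_j(\xi,\lambda)\,d\rho_j(\lambda),$$ where $\sqrt{k^2n_*^2-\lambda}=i\sqrt{\lambda-k^2n_*^2}$ for $\lambda>k^2n_*^2$.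 Let $\mu:\mathbb R^2\to(0,\infty)$ have the form $\mu(x,z)=\mu_1(x)\mu_2(z)$ with $\mu_1,\mu_2\in L^1(\mathbb R)\cap L^\infty(\mathbb R)$. Then the sets $\Lambda_s,\Lambda_a$ are finite; for $z\ne\zeta$ the integrals that define $G$ converge absolutely, and $G=G^g+G^r+G^e$ with the guided, radiation and evanescent parts $$G^g=\sum_{j}\sum_{\lambda\in\Lambda_j}\frac{e^{i|z-\zeta|\sqrt{k^2n_*^2-\lambda}}}{2i\sqrt{k^2n_*^2-\lambda}}\,v_j(x,\lambda)v_j(\xi,\lambda)\,r_j(\lambda),$$ $$G^r=\frac1{2\pi}\sum_j\int_{d^2}^{k^2n_*^2}\frac{e^{i|z-\zeta|\sqrt{k^2n_*^2-\lambda}}}{2i\sqrt{k^2n_*^2-\lambda}}\,v_j(x,\lambda)v_j(\xi,\lambda)\,\sigma_j(\lambda)\,d\lambda,$$ $$G^e=-\frac1{2\pi}\sum_j\int_{k^2n_*^2}^{\infty}\frac{e^{-|z-\zeta|\sqrt{\lambda-k^2n_*^2}}}{2\sqrt{\lambda-k^2n_*^2}}\,v_j(x,\lambda)v_j(\xi,\lambda)\,\sigma_j(\lambda)\,d\lambda;$$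 and $G$ is measurable with $$\|G\|_{L^2(\mu\times\mu)}^2=\int_{\mathbb R^2\times\mathbb R^2}|G(x,z;\xi,\zeta)|^2\,\mu(x,z)\,\mu(\xi,\zeta)\,dx\,dz\,d\xi\,d\zeta<\infty.$$ -/

import Mathlib

open MeasureTheory

namespace OpenWaveguide

/-- A rectilinear open waveguide: wavenumber `k`, half-width `h` of the core, constant index of
refraction `nCl` of the cladding, and index `nCo` of the core, an even bounded measurable function
of the transversal coordinate (only its values on `[-h, h]` are used). -/
structure Waveguide where
  k : ℝ
  h : ℝ
  nCl : ℝ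
  nCo : ℝ → ℝ
  k_pos : 0 < k
  h_pos : 0 < h
  nCl_pos : 0 < nCl
  nCo_measurable : Measurable nCo
  nCo_nonneg : ∀ x ∈ Set.Icc (-h) h, 0 ≤ nCo x
  nCo_bounded : ∃ M : ℝ, ∀ x ∈ Set.Icc (-h) h, nCo x ≤ M
  nCo_even : ∀ x ∈ Set.Icc (-h) h, nCo (-x) = nCo x

/-- The two families of solutions: `s` (symmetric) and `a` (antisymmetric). -/
inductive Parity where
  | s : Parity
  | a : Parity

namespace Waveguide

/-- The index of refraction `n(x)`: `nCo` for `|x| ≤ h`, `nCl` for `|x| > h`. -/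
noncomputable def index (w : Waveguide) (x : ℝ) : ℝ :=
  if |x| ≤ w.h then w.nCo x else w.nCl

/-- `n_*`, the supremum of the index of refraction over the line. -/
noncomputable def nStar (w : Waveguide) : ℝ := ⨆ x : ℝ, w.index x

/-- The potential `q(x) = k² (n_*² - n(x)²)`. -/
noncomputable def q (w : Waveguide) (x : ℝ) : ℝ := w.k ^ 2 * (w.nStar ^ 2 - w.index x ^ 2)

/-- The threshold `d² = k² (n_*² - n_cl²)`. -/
noncomputable def dSq (w : Waveguide) : ℝ := w.k ^ 2 * (w.nStar ^ 2 - w.nCl ^ 2)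

/-- The threshold `k² n_*²` between radiation and evanescent modes. -/
noncomputable def kappaSq (w : Waveguide) : ℝ := w.k ^ 2 * w.nStar ^ 2

/-- `φ` solves `φ'' + (lam - q) φ = 0` on `[-h, h]`, with `φ(0) = α`, `φ'(0) = β` and derivative
`φ'`, in the sense of Carathéodory: `φ` and `φ'` are continuous on `[-h, h]` and satisfy the
integrated first order system. -/
structure IsSolution (w : Waveguide) (lam α β : ℝ) (φ φ' : ℝ → ℝ) : Prop where
  continuousOn : ContinuousOn φ (Set.Icc (-w.h) w.h)
  continuousOn' : ContinuousOn φ' (Set.Icc (-w.h) w.h)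
  eq : ∀ x ∈ Set.Icc (-w.h) w.h, φ x = α + ∫ t in (0 : ℝ)..x, φ' t
  eq' : ∀ x ∈ Set.Icc (-w.h) w.h, φ' x = β + ∫ t in (0 : ℝ)..x, (w.q t - lam) * φ t

end Waveguide

section Volterra

variable {E : Type*} [NormedAddCommGroup E] [NormedSpace ℝ E]

/-- Picard iterates of the linear system `y' = A y`. -/
noncomputable def picardTerm (A : ℝ → E →L[ℝ] E) (y₀ : E) : ℕ → ℝ → E
  | 0 => fun _ => y₀
  | n + 1 => fun x => ∫ t in (0 : ℝ)..x, A t (picardTerm A y₀ n t)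

theorem intervalIntegrable_clm_apply {A : ℝ → E →L[ℝ] E} (hA : StronglyMeasurable A) {K : ℝ}
    (hK : ∀ t, ‖A t‖ ≤ K) {y : ℝ → E} {a b : ℝ} (hy : ContinuousOn y (Set.uIcc a b)) :
    IntervalIntegrable (fun t => A t (y t)) volume a b := by
  have h1 : IntervalIntegrable (fun t => K * ‖y t‖) volume a b :=
    (continuousOn_const.mul hy.norm).intervalIntegrable
  refine h1.mono_fun ?_ ?_
  · have hy' : AEStronglyMeasurable y (volume.restrict (Set.uIoc a b)) :=
      (hy.aestronglyMeasurable measurableSet_uIcc).mono_measure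
        (Measure.restrict_mono Set.uIoc_subset_uIcc le_rfl)
    exact (ContinuousLinearMap.apply ℝ E).flip.continuous₂.comp_aestronglyMeasurable
        (hA.aestronglyMeasurable.prodMk hy')
  · refine Filter.Eventually.of_forall fun t => ?_
    have h2 : ‖A t (y t)‖ ≤ K * ‖y t‖ := (A t).le_of_opNorm_le (hK t) _
    exact h2.trans (le_abs_self _)

theorem continuous_picardTerm {A : ℝ → E →L[ℝ] E} (hA : StronglyMeasurable A) {K : ℝ}
    (hK : ∀ t, ‖A t‖ ≤ K) (y₀ : E) (n : ℕ) : Continuous (picardTerm A y₀ n) := by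
  induction n with
  | zero => exact continuous_const
  | succ n ih =>
    exact intervalIntegral.continuous_primitive
      (fun a b => intervalIntegrable_clm_apply hA hK ih.continuousOn) 0

/-- If `‖f t‖ ≤ K C (K |t|)^n / n!` between `0` and `x` then the integral of `f` from `0` to `x` is
at most `C (K |x|)^(n+1) / (n+1)!`. -/
theorem norm_integral_le_pow {f : ℝ → E} {K C : ℝ} (n : ℕ) (x : ℝ)
    (hf : ∀ t ∈ Set.uIcc 0 x, ‖f t‖ ≤ K * (C * (K * |t|) ^ n / n.factorial)) :
    ‖∫ t in (0 : ℝ)..x, f t‖ ≤ C * (K * |x|) ^ (n + 1) / (n + 1).factorial := by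
  have key : ∀ (y : ℝ), 0 ≤ y → ∀ g : ℝ → E,
      (∀ t ∈ Set.Icc 0 y, ‖g t‖ ≤ K * (C * (K * |t|) ^ n / n.factorial)) →
      ‖∫ t in (0 : ℝ)..y, g t‖ ≤ C * (K * |y|) ^ (n + 1) / (n + 1).factorial := by
    intro y hy g hg
    have h1 : ‖∫ t in (0 : ℝ)..y, g t‖ ≤
        ∫ t in (0 : ℝ)..y, (K * C * K ^ n / n.factorial) * t ^ n := by
      refine intervalIntegral.norm_integral_le_of_norm_le hy ?_
        (Continuous.intervalIntegrable (by fun_prop) _ _)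
      refine Filter.Eventually.of_forall fun t ht => ?_
      have h2 := hg t ⟨ht.1.le, ht.2⟩
      rw [abs_of_pos ht.1] at h2
      refine h2.trans (le_of_eq ?_)
      rw [mul_pow]; ring
    refine h1.trans (le_of_eq ?_)
    rw [intervalIntegral.integral_const_mul, integral_pow, abs_of_nonneg hy, Nat.factorial_succ]
    have : (n.factorial : ℝ) ≠ 0 := by exact_mod_cast n.factorial_ne_zero
    have h3 : (n : ℝ) + 1 ≠ 0 := by positivity
    push_cast
    field_simp
    ring
  rcases le_total 0 x with hx | hx
  · exact key x hx f (by rwa [Set.uIcc_of_le hx] at hf)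
  · have h0 := key (-x) (by linarith) (fun t => f (-t)) (by
      intro t ht
      have h4 : -t ∈ Set.uIcc 0 x := by
        rw [Set.uIcc_of_ge hx]
        exact ⟨by linarith [ht.2], by linarith [ht.1]⟩
      have := hf (-t) h4
      rwa [abs_neg] at this)
    rw [intervalIntegral.integral_comp_neg, neg_neg, neg_zero, intervalIntegral.integral_symm,
      norm_neg, abs_neg] at h0
    exact h0

theorem norm_picardTerm_le {A : ℝ → E →L[ℝ] E} {K : ℝ} (hK : ∀ t, ‖A t‖ ≤ K) (y₀ : E) (n : ℕ)
    (x : ℝ) : ‖picardTerm A y₀ n x‖ ≤ ‖y₀‖ * (K * |x|) ^ n / n.factorial := by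
  induction n generalizing x with
  | zero => simp [picardTerm]
  | succ n ih =>
    refine norm_integral_le_pow n x fun t _ => ?_
    have hK0 : 0 ≤ K := (norm_nonneg _).trans (hK 0)
    exact ((A t).le_of_opNorm_le (hK t) _).trans (mul_le_mul_of_nonneg_left (ih t) hK0)

theorem exists_volterra [CompleteSpace E] {A : ℝ → E →L[ℝ] E} (hA : StronglyMeasurable A) {K : ℝ}
    (hK : ∀ t, ‖A t‖ ≤ K) (y₀ : E) :
    ∃ y : ℝ → E, Continuous y ∧ ∀ x, y x = y₀ + ∫ t in (0 : ℝ)..x, A t (y t) := by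
  have hK0 : 0 ≤ K := (norm_nonneg _).trans (hK 0)
  have hsum : ∀ R : ℝ, Summable fun n : ℕ => ‖y₀‖ * (K * R) ^ n / n.factorial := by
    intro R
    simpa [mul_div_assoc] using (Real.summable_pow_div_factorial (K * R)).mul_left ‖y₀‖
  have hs : ∀ x, Summable fun n => picardTerm A y₀ n x := fun x =>
    Summable.of_norm_bounded (hsum |x|) fun n => norm_picardTerm_le hK y₀ n x
  have hle : ∀ (R t : ℝ), |t| ≤ R → ∀ n,
      ‖picardTerm A y₀ n t‖ ≤ ‖y₀‖ * (K * R) ^ n / n.factorial := by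
    intro R t ht n
    refine (norm_picardTerm_le hK y₀ n t).trans ?_
    gcongr
  refine ⟨fun x => ∑' n, picardTerm A y₀ n x, ?_, fun x => ?_⟩
  · rw [continuous_iff_continuousAt]
    intro x
    have hc : ContinuousOn (fun x => ∑' n, picardTerm A y₀ n x) (Metric.ball 0 (|x| + 1)) :=
      continuousOn_tsum (fun n => (continuous_picardTerm hA hK y₀ n).continuousOn) (hsum (|x| + 1))
        fun n t ht => hle _ t (by simpa using (mem_ball_zero_iff.1 ht).le) n
    exact hc.continuousAt (Metric.isOpen_ball.mem_nhds (by simp))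
  · have h1 : HasSum (fun n => ∫ t in (0 : ℝ)..x, A t (picardTerm A y₀ n t))
        (∫ t in (0 : ℝ)..x, A t (∑' n, picardTerm A y₀ n t)) := by
      refine intervalIntegral.hasSum_integral_of_dominated_convergence
        (fun n _ => K * (‖y₀‖ * (K * |x|) ^ n / n.factorial)) (fun n => ?_) (fun n => ?_) ?_ ?_ ?_
      · exact (intervalIntegrable_clm_apply hA hK
          (continuous_picardTerm hA hK y₀ n).continuousOn).def'.aestronglyMeasurable
      · refine Filter.Eventually.of_forall fun t ht => ?_
        refine ((A t).le_of_opNorm_le (hK t) _).trans (mul_le_mul_of_nonneg_left ?_ hK0)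
        refine hle |x| t ?_ n
        have := Set.abs_sub_left_of_mem_uIcc (Set.uIoc_subset_uIcc ht)
        simpa using this
      · exact Filter.Eventually.of_forall fun t _ => (hsum |x|).mul_left K
      · exact continuous_const.intervalIntegrable _ _
      · exact Filter.Eventually.of_forall fun t _ => (A t).hasSum (hs t).hasSum
    change ∑' n, picardTerm A y₀ n x = y₀ + ∫ t in (0 : ℝ)..x, A t (∑' n, picardTerm A y₀ n t)
    rw [(hs x).tsum_eq_zero_add, ← h1.tsum_eq]
    rfl

theorem eqOn_volterra {A : ℝ → E →L[ℝ] E} {K : ℝ} (hA : StronglyMeasurable A)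
    (hK : ∀ t, ‖A t‖ ≤ K) {y₀ : E} {h : ℝ} {y₁ y₂ : ℝ → E} (c₁ : ContinuousOn y₁ (Set.Icc (-h) h))
    (c₂ : ContinuousOn y₂ (Set.Icc (-h) h))
    (e₁ : ∀ x ∈ Set.Icc (-h) h, y₁ x = y₀ + ∫ t in (0 : ℝ)..x, A t (y₁ t))
    (e₂ : ∀ x ∈ Set.Icc (-h) h, y₂ x = y₀ + ∫ t in (0 : ℝ)..x, A t (y₂ t)) :
    Set.EqOn y₁ y₂ (Set.Icc (-h) h) := by
  intro x₀ hx₀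
  have hK0 : 0 ≤ K := (norm_nonneg _).trans (hK 0)
  have h0 : (0 : ℝ) ∈ Set.Icc (-h) h := by
    have := hx₀.1.trans hx₀.2
    exact ⟨by linarith, by linarith⟩
  have hsub : ∀ x ∈ Set.Icc (-h) h, Set.uIcc 0 x ⊆ Set.Icc (-h) h := fun x hx =>
    Set.uIcc_subset_Icc h0 hx
  obtain ⟨M, hM⟩ := isCompact_Icc.exists_bound_of_continuousOn (c₁.sub c₂)
  have hd : ∀ x ∈ Set.Icc (-h) h, y₁ x - y₂ x = ∫ t in (0 : ℝ)..x, A t (y₁ t - y₂ t) := by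
    intro x hx
    have i₁ := intervalIntegrable_clm_apply hA hK (c₁.mono (hsub x hx))
    have i₂ := intervalIntegrable_clm_apply hA hK (c₂.mono (hsub x hx))
    simp only [map_sub]
    rw [intervalIntegral.integral_sub i₁ i₂, e₁ x hx, e₂ x hx]
    abel
  have hb : ∀ n : ℕ, ∀ x ∈ Set.Icc (-h) h,
      ‖y₁ x - y₂ x‖ ≤ M * (K * |x|) ^ n / n.factorial := by
    intro n
    induction n with
    | zero => intro x hx; simpa using hM x hx
    | succ n ih =>
      intro x hx
      rw [hd x hx]
      refine norm_integral_le_pow n x fun t ht => ?_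
      exact ((A t).le_of_opNorm_le (hK t) _).trans
        (mul_le_mul_of_nonneg_left (ih t (hsub x hx ht)) hK0)
  have hlim : Filter.Tendsto (fun n : ℕ => M * (K * |x₀|) ^ n / n.factorial) Filter.atTop
      (nhds 0) := by
    simpa [mul_div_assoc] using
      (FloorSemiring.tendsto_pow_div_factorial_atTop (K * |x₀|)).const_mul M
  have := ge_of_tendsto' hlim fun n => hb n x₀ hx₀
  exact sub_eq_zero.1 (norm_le_zero_iff.1 this)

end Volterra

namespace Waveguide

theorem measurable_index (w : Waveguide) : Measurable w.index :=
  Measurable.ite (measurableSet_le (by fun_prop) measurable_const) w.nCo_measurable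
    measurable_const

theorem measurable_q (w : Waveguide) : Measurable w.q := by
  have := w.measurable_index
  unfold q
  fun_prop

theorem exists_abs_q_le (w : Waveguide) : ∃ K : ℝ, ∀ x, |w.q x| ≤ K := by
  obtain ⟨M, hM⟩ := w.nCo_bounded
  have hI : ∀ x, 0 ≤ w.index x ∧ w.index x ≤ max M w.nCl := by
    intro x
    unfold index
    split_ifs with hx
    · exact ⟨w.nCo_nonneg x (abs_le.1 hx), (hM x (abs_le.1 hx)).trans (le_max_left _ _)⟩
    · exact ⟨w.nCl_pos.le, le_max_right _ _⟩
  refine ⟨w.k ^ 2 * (w.nStar ^ 2 + (max M w.nCl) ^ 2), fun x => ?_⟩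
  have h1 : w.index x ^ 2 ≤ (max M w.nCl) ^ 2 := pow_le_pow_left₀ (hI x).1 (hI x).2 2
  have h2 := sq_nonneg (w.index x)
  have h3 := sq_nonneg w.nStar
  have h4 := sq_nonneg (max M w.nCl)
  rw [q, abs_mul, abs_of_nonneg (sq_nonneg w.k)]
  exact mul_le_mul_of_nonneg_left (abs_le.2 ⟨by linarith, by linarith⟩) (sq_nonneg w.k)

/-- The coefficient of the first order system for `(φ, φ')`. -/
noncomputable def system (w : Waveguide) (lam : ℝ) (t : ℝ) : ℝ × ℝ →L[ℝ] ℝ × ℝ :=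
  (ContinuousLinearMap.inl ℝ ℝ ℝ).comp (ContinuousLinearMap.snd ℝ ℝ ℝ) +
    (w.q t - lam) • (ContinuousLinearMap.inr ℝ ℝ ℝ).comp (ContinuousLinearMap.fst ℝ ℝ ℝ)

theorem system_apply (w : Waveguide) (lam t : ℝ) (y : ℝ × ℝ) :
    w.system lam t y = (y.2, (w.q t - lam) * y.1) := by
  simp [system]

theorem stronglyMeasurable_system (w : Waveguide) (lam : ℝ) :
    StronglyMeasurable (w.system lam) :=
  stronglyMeasurable_const.add
    ((w.measurable_q.stronglyMeasurable.sub stronglyMeasurable_const).smul_const _)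

theorem exists_norm_system_le (w : Waveguide) (lam : ℝ) : ∃ K : ℝ, ∀ t, ‖w.system lam t‖ ≤ K := by
  obtain ⟨K, hK⟩ := w.exists_abs_q_le
  set B := (ContinuousLinearMap.inl ℝ ℝ ℝ).comp (ContinuousLinearMap.snd ℝ ℝ ℝ)
  set C := (ContinuousLinearMap.inr ℝ ℝ ℝ).comp (ContinuousLinearMap.fst ℝ ℝ ℝ)
  refine ⟨‖B‖ + (K + |lam|) * ‖C‖, fun t => ?_⟩
  have h1 : ‖w.q t - lam‖ ≤ K + |lam| := (norm_sub_le _ _).trans (add_le_add (hK t) le_rfl)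
  calc ‖w.system lam t‖ = ‖B + (w.q t - lam) • C‖ := rfl
    _ ≤ ‖B‖ + ‖(w.q t - lam) • C‖ := norm_add_le _ _
    _ = ‖B‖ + ‖w.q t - lam‖ * ‖C‖ := by rw [norm_smul]
    _ ≤ ‖B‖ + (K + |lam|) * ‖C‖ := by gcongr

/-- Components of an integral with values in `ℝ × ℝ`. -/
theorem integral_system (w : Waveguide) (lam : ℝ) {y : ℝ → ℝ × ℝ} {x : ℝ}
    (hy : ContinuousOn y (Set.uIcc 0 x)) :
    ∫ t in (0 : ℝ)..x, w.system lam t (y t) =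
      (∫ t in (0 : ℝ)..x, (y t).2, ∫ t in (0 : ℝ)..x, (w.q t - lam) * (y t).1) := by
  obtain ⟨K, hK⟩ := w.exists_norm_system_le lam
  have hi := intervalIntegrable_clm_apply (w.stronglyMeasurable_system lam) hK hy
  have h1 := (ContinuousLinearMap.fst ℝ ℝ ℝ).intervalIntegral_comp_comm hi
  have h2 := (ContinuousLinearMap.snd ℝ ℝ ℝ).intervalIntegral_comp_comm hi
  simp only [system_apply, ContinuousLinearMap.coe_fst', ContinuousLinearMap.coe_snd'] at h1 h2 ⊢
  exact Prod.ext h1.symm h2.symm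

/-- The initial value problem on `[-h, h]` has a solution. -/
theorem exists_isSolution (w : Waveguide) (lam α β : ℝ) :
    ∃ p : (ℝ → ℝ) × (ℝ → ℝ), w.IsSolution lam α β p.1 p.2 := by
  obtain ⟨K, hK⟩ := w.exists_norm_system_le lam
  obtain ⟨y, hc, hy⟩ := exists_volterra (w.stronglyMeasurable_system lam) hK (α, β)
  have h := fun x => (hy x).trans (congrArg _ (w.integral_system lam hc.continuousOn))
  exact ⟨(fun x => (y x).1, fun x => (y x).2), hc.fst.continuousOn, hc.snd.continuousOn,
    fun x _ => congrArg Prod.fst (h x), fun x _ => congrArg Prod.snd (h x)⟩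

/-- The solution of the initial value problem on `[-h, h]` is unique. -/
theorem IsSolution.eqOn {w : Waveguide} {lam α β : ℝ} {φ φ' ψ ψ' : ℝ → ℝ}
    (hφ : w.IsSolution lam α β φ φ') (hψ : w.IsSolution lam α β ψ ψ') :
    Set.EqOn φ ψ (Set.Icc (-w.h) w.h) ∧ Set.EqOn φ' ψ' (Set.Icc (-w.h) w.h) := by
  obtain ⟨K, hK⟩ := w.exists_norm_system_le lam
  have h0 : (0 : ℝ) ∈ Set.Icc (-w.h) w.h := ⟨by linarith [w.h_pos], w.h_pos.le⟩
  have key : ∀ {φ φ' : ℝ → ℝ}, w.IsSolution lam α β φ φ' → ∀ x ∈ Set.Icc (-w.h) w.h,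
      (φ x, φ' x) = (α, β) + ∫ t in (0 : ℝ)..x, w.system lam t (φ t, φ' t) := by
    intro φ φ' hs x hx
    rw [w.integral_system lam ((hs.continuousOn.prodMk hs.continuousOn').mono
      (Set.uIcc_subset_Icc h0 hx))]
    exact Prod.ext (hs.eq x hx) (hs.eq' x hx)
  have := eqOn_volterra (w.stronglyMeasurable_system lam) hK
    (hφ.continuousOn.prodMk hφ.continuousOn') (hψ.continuousOn.prodMk hψ.continuousOn')
    (key hφ) (key hψ)
  exact ⟨fun x hx => congrArg Prod.fst (this hx), fun x hx => congrArg Prod.snd (this hx)⟩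

/-- Initial value `φ_j(0, lam)`. -/
noncomputable def initVal : Parity → ℝ
  | .s => 1
  | .a => 0

/-- Initial slope `φ_j'(0, lam)`. -/
noncomputable def initSlope : Parity → ℝ → ℝ
  | .s, _ => 0
  | .a, lam => √lam

/-- `φ_j(·, lam)`, the solution on `[-h, h]` with the initial data of the parity `j`. -/
noncomputable def phi (w : Waveguide) (j : Parity) (lam : ℝ) : ℝ → ℝ :=
  (w.exists_isSolution lam (initVal j) (initSlope j lam)).choose.1

/-- `φ_j'(·, lam)`, the derivative of `φ_j(·, lam)` on `[-h, h]`. -/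
noncomputable def phi' (w : Waveguide) (j : Parity) (lam : ℝ) : ℝ → ℝ :=
  (w.exists_isSolution lam (initVal j) (initSlope j lam)).choose.2

theorem isSolution_phi (w : Waveguide) (j : Parity) (lam : ℝ) :
    w.IsSolution lam (initVal j) (initSlope j lam) (w.phi j lam) (w.phi' j lam) :=
  (w.exists_isSolution lam (initVal j) (initSlope j lam)).choose_spec

/-- The eigenvalues `lam_m^j` of the guided modes of parity `j`. -/
def guidedEigenvalues (w : Waveguide) (j : Parity) : Set ℝ :=
  {lam | 0 < lam ∧ lam < w.dSq ∧ √(w.dSq - lam) * w.phi j lam w.h + w.phi' j lam w.h = 0}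

/-- The generalized eigenfunctions `v_j(x, lam)` on the line. Above the threshold `d²` they are
continued outside of the core by trigonometric functions with `Q = √(lam - d²)`; below it they are
used only at the guided eigenvalues, where the continuation decays exponentially. -/
noncomputable def v (w : Waveguide) (j : Parity) (x lam : ℝ) : ℝ :=
  if |x| ≤ w.h then w.phi j lam x
  else if w.dSq < lam then
    let Q := √(lam - w.dSq)
    if w.h < x then
      w.phi j lam w.h * Real.cos (Q * (x - w.h)) + w.phi' j lam w.h / Q * Real.sin (Q * (x - w.h))
    else
      w.phi j lam (-w.h) * Real.cos (Q * (x + w.h)) +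
        w.phi' j lam (-w.h) / Q * Real.sin (Q * (x + w.h))
  else
    if w.h < x then w.phi j lam w.h * Real.exp (-√(w.dSq - lam) * (x - w.h))
    else w.phi j lam (-w.h) * Real.exp (√(w.dSq - lam) * (x + w.h))

/-- The normalization `r_m^j` at a guided eigenvalue. -/
noncomputable def r (w : Waveguide) (j : Parity) (lam : ℝ) : ℝ := (∫ x : ℝ, w.v j x lam ^ 2)⁻¹

/-- The spectral density `σ_j(lam)`, for `lam > d²`. -/
noncomputable def sigma (w : Waveguide) (j : Parity) (lam : ℝ) : ℝ :=
  √(lam - w.dSq) / ((lam - w.dSq) * w.phi j lam w.h ^ 2 + w.phi' j lam w.h ^ 2)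

/-- The spectral measure `dρ_j`: an atom of mass `r_m^j` at each guided eigenvalue and the density
`σ_j / (2π)` on `(d², ∞)`. -/
noncomputable def rho (w : Waveguide) (j : Parity) : Measure ℝ :=
  Measure.sum (fun lam : w.guidedEigenvalues j =>
      ENNReal.ofReal (w.r j lam) • Measure.dirac (lam : ℝ)) +
    (volume.restrict (Set.Ioi w.dSq)).withDensity
      (fun lam => ENNReal.ofReal (w.sigma j lam / (2 * Real.pi)))

/-- The square root `√(k² n_*² - lam)`, equal to `i √(lam - k² n_*²)` for `lam > k² n_*²`. -/
noncomputable def axialRoot (w : Waveguide) (lam : ℝ) : ℂ :=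
  if lam ≤ w.kappaSq then (√(w.kappaSq - lam) : ℂ) else Complex.I * (√(lam - w.kappaSq) : ℂ)

/-- The integrand `e^{i|z-ζ|√(k²n_*²-lam)} / (2i√(k²n_*²-lam)) v_j(x, lam) v_j(ξ, lam)` of the
spectral representation, at the points `p = (x, z)` and `p' = (ξ, ζ)`. -/
noncomputable def modeKernel (w : Waveguide) (j : Parity) (p p' : ℝ × ℝ) (lam : ℝ) : ℂ :=
  Complex.exp (Complex.I * (|p.2 - p'.2| : ℝ) * w.axialRoot lam) /
      (2 * Complex.I * w.axialRoot lam) * (w.v j p.1 lam : ℂ) * (w.v j p'.1 lam : ℂ)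

/-- The Green's function `G(x, z; ξ, ζ)`. -/
noncomputable def green (w : Waveguide) (p p' : ℝ × ℝ) : ℂ :=
  (∫ lam, w.modeKernel .s p p' lam ∂(w.rho .s)) + ∫ lam, w.modeKernel .a p p' lam ∂(w.rho .a)

/-- The contribution of parity `j` to the guided part. -/
noncomputable def guidedTerm (w : Waveguide) (j : Parity) (p p' : ℝ × ℝ) : ℂ :=
  ∑ᶠ lam ∈ w.guidedEigenvalues j,
    Complex.exp (Complex.I * (|p.2 - p'.2| : ℝ) * (√(w.kappaSq - lam) : ℂ)) /
      (2 * Complex.I * (√(w.kappaSq - lam) : ℂ)) *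
        (w.v j p.1 lam : ℂ) * (w.v j p'.1 lam : ℂ) * (w.r j lam : ℂ)

/-- The contribution of parity `j` to the radiation part, without the factor `1 / (2π)`. -/
noncomputable def radiationTerm (w : Waveguide) (j : Parity) (p p' : ℝ × ℝ) : ℂ :=
  ∫ lam in Set.Ioo w.dSq w.kappaSq,
    Complex.exp (Complex.I * (|p.2 - p'.2| : ℝ) * (√(w.kappaSq - lam) : ℂ)) /
      (2 * Complex.I * (√(w.kappaSq - lam) : ℂ)) *
        (w.v j p.1 lam : ℂ) * (w.v j p'.1 lam : ℂ) * (w.sigma j lam : ℂ)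

/-- The contribution of parity `j` to the evanescent part, without the factor `-1 / (2π)`. -/
noncomputable def evanescentTerm (w : Waveguide) (j : Parity) (p p' : ℝ × ℝ) : ℝ :=
  ∫ lam in Set.Ioi w.kappaSq,
    Real.exp (-|p.2 - p'.2| * √(lam - w.kappaSq)) / (2 * √(lam - w.kappaSq)) *
      w.v j p.1 lam * w.v j p'.1 lam * w.sigma j lam

/-- The guided part `G^g`. -/
noncomputable def greenGuided (w : Waveguide) (p p' : ℝ × ℝ) : ℂ :=
  w.guidedTerm .s p p' + w.guidedTerm .a p p'

/-- The radiation part `G^r`. -/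
noncomputable def greenRadiation (w : Waveguide) (p p' : ℝ × ℝ) : ℂ :=
  1 / (2 * Real.pi) * (w.radiationTerm .s p p' + w.radiationTerm .a p p')

/-- The evanescent part `G^e`. -/
noncomputable def greenEvanescent (w : Waveguide) (p p' : ℝ × ℝ) : ℂ :=
  ((-(1 / (2 * Real.pi)) * (w.evanescentTerm .s p p' + w.evanescentTerm .a p p') : ℝ) : ℂ)

end Waveguide

/-- The weighted norm `‖u‖_{L²(ν)} = (∫ |u|² ν)^{1/2}`, as the `L²` norm of `ν^{1/2} u`. -/
noncomputable def weightedL2Norm {X : Type*} [MeasureSpace X] (ν : X → ℝ) (u : X → ℂ) : ENNReal :=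
  eLpNorm (fun p => ((√(ν p) : ℝ) : ℂ) * u p) 2 volume

end OpenWaveguide

/-!
The Green's function is bounded by `C (1 + |z - ζ|^{-1/4})` uniformly in the transversal variables,
and the square of this bound is integrable against `μ ⊗ μ`, because `μ₂` is bounded and integrable.

For the continuous spectrum put `Q = √(lam - d²)`. Outside of the core `v_j` is a combination of
`cos` and `sin` whose amplitude is given by the Cauchy data of `φ_j` at `h`, so that
`v_j² ≤ φ_j(h)² + φ_j'(h)² / Q² = 1 / (Q σ_j)`. Inside of the core the energy
`φ'² + max(1, Q)² φ²` varies at most by a factor independent of `lam`, so `v_j²` is bounded by a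
multiple of the same quantity. Hence `|v_j(x, lam) v_j(ξ, lam)| σ_j(lam) ≤ C / Q` for all `x`, `ξ`
and `lam > d²` (`exists_abs_v_mul_v_mul_sigma_le`), whatever happens at the thresholds. As
`d² < k² n_*²`, the two inverse square roots in the integrand are singular at different points; for
`lam > k² n_*²`, `e^{-ts} ≤ (ts)^{-1/4}` gives decay at infinity at the price of the factor
`t^{-1/4}`, where `t = |z - ζ|` (`exists_norm_modeKernel_mul_sigma_le`).

The guided modes are bounded functions, so it remains to see that there are finitely many of them.
For distinct eigenvalues `l₁`, `l₂` with decay rates `s₁`, `s₂` the Wronskian identity gives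
`(s₁ + s₂) ∫₀ʰ ψ₁ ψ₂ = - ψ₁(h) ψ₂(h)` (`integral_psi_mul_psi_eq`). Near an accumulation point, which
lies in `[0, d²]`, the two sides would have opposite signs, by continuity of the solutions in the
spectral parameter (`eventually_eq_of_mem_guidedEigenvalues`). No analyticity in `lam` is needed,
and the endpoints `0` and `d²` need no separate treatment, because the solutions are normalized
independently of `lam`.

Joint continuity of the solutions in `(x, lam)` (`continuous_sol_uncurry`) and the explicit form of
`v_j` outside of the core also give the measurability of `G`.
-/

namespace OpenWaveguide

/-! ### Solutions on the whole line and their dependence on the spectral parameter -/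

/-- Product rule for primitives of integrable functions; solutions in the sense of Carathéodory are
of this form, with derivatives that need not exist everywhere. -/
theorem integral_mul_add_mul_of_primitive {F G f g : ℝ → ℝ} {a₀ b₀ : ℝ}
    (hf : ∀ a b, IntervalIntegrable f volume a b) (hg : ∀ a b, IntervalIntegrable g volume a b)
    (hF : ∀ x, F x = a₀ + ∫ t in (0 : ℝ)..x, f t) (hG : ∀ x, G x = b₀ + ∫ t in (0 : ℝ)..x, g t)
    (a b : ℝ) : ∫ t in a..b, (f t * G t + F t * g t) = F b * G b - F a * G a := by
  have key : ∀ {F f : ℝ → ℝ} {a₀ : ℝ}, (∀ a b, IntervalIntegrable f volume a b) →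
      (∀ x, F x = a₀ + ∫ t in (0 : ℝ)..x, f t) → AbsolutelyContinuousOnInterval F a b ∧
      ∀ᵐ x, x ∈ Set.uIcc a b → HasDerivAt F (f x) x := by
    intro F f a₀ hf hF
    have hF' : F = fun x => F a + ∫ t in a..x, f t := by
      funext x
      rw [hF x, hF a, add_assoc, intervalIntegral.integral_add_adjacent_intervals (hf _ _) (hf _ _)]
    constructor
    · rw [hF']
      have h1 := (hf a b).absolutelyContinuousOnInterval_intervalIntegral (c := a) (by simp)
      have h2 : AbsolutelyContinuousOnInterval (fun _ : ℝ => F a) a b :=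
        (LipschitzWith.const (F a)).lipschitzOnWith.absolutelyContinuousOnInterval
      exact h2.add h1
    · filter_upwards [(hf a b).ae_hasDerivAt_integral] with x hx hxab
      rw [hF']
      exact (hx hxab a (by simp)).const_add _
  obtain ⟨hFac, hFd⟩ := key hf hF
  obtain ⟨hGac, hGd⟩ := key hg hG
  rw [← hFac.integral_deriv_mul_eq_sub hGac]
  refine intervalIntegral.integral_congr_ae ?_
  filter_upwards [hFd, hGd] with x h1 h2 hx
  rw [(h1 (Set.uIoc_subset_uIcc hx)).deriv, (h2 (Set.uIoc_subset_uIcc hx)).deriv]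

theorem norm_add_smul_clm_le {E F : Type*} [NormedAddCommGroup E] [NormedSpace ℝ E]
    [NormedAddCommGroup F] [NormedSpace ℝ F] (B C : E →L[ℝ] F) (a : ℝ) :
    ‖B + a • C‖ ≤ ‖B‖ + |a| * ‖C‖ :=
  (norm_add_le _ _).trans (by rw [norm_smul, Real.norm_eq_abs])

namespace Waveguide

variable (w : Waveguide)

/-- The pair `(φ, φ')` for the solution on the whole line of `φ'' + (lam - q) φ = 0` with
`φ(0) = α`, `φ'(0) = β`. -/
noncomputable def sol (α β lam : ℝ) : ℝ → ℝ × ℝ :=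
  (exists_volterra (w.stronglyMeasurable_system lam) (w.exists_norm_system_le lam).choose_spec
    (α, β)).choose

theorem continuous_sol (α β lam : ℝ) : Continuous (w.sol α β lam) :=
  (exists_volterra (w.stronglyMeasurable_system lam) (w.exists_norm_system_le lam).choose_spec
    (α, β)).choose_spec.1

theorem sol_eq (α β lam x : ℝ) :
    w.sol α β lam x = (α, β) + ∫ t in (0 : ℝ)..x, w.system lam t (w.sol α β lam t) :=
  (exists_volterra (w.stronglyMeasurable_system lam) (w.exists_norm_system_le lam).choose_spec
    (α, β)).choose_spec.2 x

-- only the integral equation is used from here on; unfolding the choice is slow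
attribute [irreducible] sol

theorem sol_fst_eq (α β lam x : ℝ) :
    (w.sol α β lam x).1 = α + ∫ t in (0 : ℝ)..x, (w.sol α β lam t).2 :=
  congrArg Prod.fst ((w.sol_eq α β lam x).trans
    (congrArg _ (w.integral_system lam (w.continuous_sol α β lam).continuousOn)))

theorem sol_snd_eq (α β lam x : ℝ) :
    (w.sol α β lam x).2 = β + ∫ t in (0 : ℝ)..x, (w.q t - lam) * (w.sol α β lam t).1 :=
  congrArg Prod.snd ((w.sol_eq α β lam x).trans
    (congrArg _ (w.integral_system lam (w.continuous_sol α β lam).continuousOn)))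

theorem isSolution_sol (α β lam : ℝ) :
    w.IsSolution lam α β (fun x => (w.sol α β lam x).1) fun x => (w.sol α β lam x).2 :=
  ⟨(w.continuous_sol α β lam).fst.continuousOn, (w.continuous_sol α β lam).snd.continuousOn,
    fun x _ => w.sol_fst_eq α β lam x, fun x _ => w.sol_snd_eq α β lam x⟩

/-- Uniqueness of the solution on the whole line. -/
theorem eq_sol {α β lam : ℝ} {φ φ' : ℝ → ℝ} (hφ : Continuous φ) (hφ' : Continuous φ')
    (h : ∀ x, φ x = α + ∫ t in (0 : ℝ)..x, φ' t)
    (h' : ∀ x, φ' x = β + ∫ t in (0 : ℝ)..x, (w.q t - lam) * φ t) (x : ℝ) :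
    φ x = (w.sol α β lam x).1 ∧ φ' x = (w.sol α β lam x).2 := by
  obtain ⟨K, hK⟩ := w.exists_norm_system_le lam
  have hc := hφ.prodMk hφ'
  have := eqOn_volterra (h := |x|) (w.stronglyMeasurable_system lam) hK hc.continuousOn
    (w.continuous_sol α β lam).continuousOn (y₀ := (α, β)) (fun y _ => by
      rw [w.integral_system lam hc.continuousOn]
      exact Prod.ext (h y) (h' y)) (fun y _ => w.sol_eq α β lam y)
    (⟨neg_abs_le x, le_abs_self x⟩ : x ∈ Set.Icc (-|x|) |x|)
  exact ⟨congrArg Prod.fst this, congrArg Prod.snd this⟩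

theorem intervalIntegrable_q_sub_mul {φ : ℝ → ℝ} (hφ : Continuous φ) (lam a b : ℝ) :
    IntervalIntegrable (fun t => (w.q t - lam) * φ t) volume a b := by
  obtain ⟨K, hK⟩ := w.exists_norm_system_le lam
  have h1 := intervalIntegrable_clm_apply (w.stronglyMeasurable_system lam) hK
    (y := fun t => (φ t, 0)) (a := a) (b := b) (by fun_prop)
  have h2 : IntervalIntegrable (fun t => (w.system lam t (φ t, 0)).2) volume a b :=
    ⟨h1.1.snd, h1.2.snd⟩
  simpa [system_apply] using h2

/-- The solutions for all `lam` in a compact interval `I` solve together one Volterra equation with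
values in `C(I) × C(I)`, whose solution is a continuous curve; this gives joint continuity. -/
theorem continuous_sol_uncurry (α β : ℝ) :
    Continuous fun p : ℝ × ℝ => w.sol α β p.2 p.1 := by
  rw [continuous_iff_continuousAt]
  rintro ⟨x₀, lam₀⟩
  set I : Set ℝ := Set.Icc (lam₀ - 1) (lam₀ + 1)
  have : CompactSpace I := isCompact_iff_compactSpace.1 isCompact_Icc
  let idI : C(I, ℝ) := ⟨Subtype.val, continuous_subtype_val⟩
  let S : C(I, ℝ) × C(I, ℝ) →L[ℝ] C(I, ℝ) := ContinuousLinearMap.snd ℝ C(I, ℝ) C(I, ℝ)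
  let F : C(I, ℝ) × C(I, ℝ) →L[ℝ] C(I, ℝ) := ContinuousLinearMap.fst ℝ C(I, ℝ) C(I, ℝ)
  let B : C(I, ℝ) × C(I, ℝ) →L[ℝ] C(I, ℝ) × C(I, ℝ) :=
    (ContinuousLinearMap.inl ℝ C(I, ℝ) C(I, ℝ)).comp S -
    (ContinuousLinearMap.inr ℝ C(I, ℝ) C(I, ℝ)).comp
      ((ContinuousLinearMap.mul ℝ C(I, ℝ) idI).comp F)
  let C : C(I, ℝ) × C(I, ℝ) →L[ℝ] C(I, ℝ) × C(I, ℝ) :=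
    (ContinuousLinearMap.inr ℝ C(I, ℝ) C(I, ℝ)).comp F
  let A : ℝ → C(I, ℝ) × C(I, ℝ) →L[ℝ] C(I, ℝ) × C(I, ℝ) := fun t => B + w.q t • C
  have hA : StronglyMeasurable A :=
    stronglyMeasurable_const.add (w.measurable_q.stronglyMeasurable.smul_const _)
  obtain ⟨K, hK⟩ := w.exists_abs_q_le
  have hAK : ∀ t, ‖A t‖ ≤ ‖B‖ + K * ‖C‖ := by
    intro t
    exact (norm_add_smul_clm_le B C (w.q t)).trans (by gcongr; exact hK t)
  obtain ⟨y, hyc, hy⟩ := exists_volterra hA hAK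
    ((ContinuousMap.const I α, ContinuousMap.const I β) : C(I, ℝ) × C(I, ℝ))
  have hsol : ∀ (l : I) (x : ℝ), ((y x).1 l, (y x).2 l) = w.sol α β l x := by
    intro l x
    let ev : C(I, ℝ) →L[ℝ] ℝ := ContinuousMap.evalCLM ℝ l
    have e : ∀ x, ((y x).1 l, (y x).2 l) =
        (α, β) + ∫ t in (0 : ℝ)..x, w.system l t ((y t).1 l, (y t).2 l) := by
      intro x
      have h2 := congrArg (ev.prodMap ev) (hy x)
      rw [map_add, ← ContinuousLinearMap.intervalIntegral_comp_comm _
        (intervalIntegrable_clm_apply hA hAK hyc.continuousOn)] at h2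
      refine h2.trans (congrArg _ (intervalIntegral.integral_congr fun t _ => ?_))
      have h3 : ∀ p : C(I, ℝ) × C(I, ℝ), (ev.prodMap ev) p = (p.1 l, p.2 l) := fun p => rfl
      rw [h3, system_apply]
      simp only [A, B, C, S, F, add_apply, sub_apply, smul_apply,
        ContinuousLinearMap.comp_apply, ContinuousLinearMap.inl_apply,
        ContinuousLinearMap.inr_apply, ContinuousLinearMap.coe_fst', ContinuousLinearMap.coe_snd',
        ContinuousLinearMap.mul_apply', Prod.fst_add, Prod.snd_add, Prod.fst_sub, Prod.snd_sub,
        Prod.smul_fst, Prod.smul_snd, ContinuousMap.add_apply, ContinuousMap.sub_apply,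
        ContinuousMap.smul_apply, ContinuousMap.mul_apply, ContinuousMap.zero_apply]
      simp [idI]
      ring
    have hc : Continuous fun x => ((y x).1 l, (y x).2 l) :=
      ((ev.prodMap ev).continuous.comp hyc :)
    have := w.eq_sol (α := α) (β := β) (lam := l) hc.fst hc.snd
      (fun x => congrArg Prod.fst ((e x).trans
        (congrArg _ (w.integral_system l hc.continuousOn))))
      (fun x => congrArg Prod.snd ((e x).trans
        (congrArg _ (w.integral_system l hc.continuousOn)))) x
    exact Prod.ext this.1 this.2
  have hcont : ContinuousOn (fun p : ℝ × ℝ => w.sol α β p.2 p.1) (Set.univ ×ˢ I) := by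
    rw [continuousOn_iff_continuous_domRestrict]
    have h1 : Continuous fun p : (Set.univ ×ˢ I : Set (ℝ × ℝ)) =>
        ((y p.1.1).1 ⟨p.1.2, p.2.2⟩, (y p.1.1).2 ⟨p.1.2, p.2.2⟩) := by
      have h3 : Continuous fun p : (Set.univ ×ˢ I : Set (ℝ × ℝ)) => y p.1.1 := by fun_prop
      have h4 : Continuous fun p : (Set.univ ×ˢ I : Set (ℝ × ℝ)) => (⟨p.1.2, p.2.2⟩ : I) := by
        fun_prop
      exact (h3.fst.eval h4).prodMk (h3.snd.eval h4)
    refine h1.congr fun p => ?_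
    exact hsol ⟨p.1.2, p.2.2⟩ p.1.1
  refine hcont.continuousAt ?_
  exact prod_mem_nhds Filter.univ_mem (Icc_mem_nhds (by linarith) (by linarith))

/-! ### Parity -/

theorem index_neg (x : ℝ) : w.index (-x) = w.index x := by
  unfold index
  rw [abs_neg]
  split_ifs with h
  · exact w.nCo_even x (abs_le.1 h)
  · rfl

theorem q_neg (x : ℝ) : w.q (-x) = w.q x := by
  rw [q, q, index_neg]

/-- Slope at `0` of the solution of parity `j`, normalized independently of `lam`. -/
noncomputable def unitSlope : Parity → ℝ
  | .s => 0
  | .a => 1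

/-- The factor between `φ_j` and the solution with initial data independent of `lam`. -/
noncomputable def scale : Parity → ℝ → ℝ
  | .s, _ => 1
  | .a, lam => √lam

/-- The sign of the reflection `x ↦ -x` on functions of parity `j`. -/
def sign : Parity → ℝ
  | .s => 1
  | .a => -1

/-- The pair `(ψ_j, ψ_j')` for the solution of parity `j` with initial data independent of `lam`;
it is a continuous function of `(x, lam)`, and `φ_j = scale j lam * ψ_j`. -/
noncomputable def psi (j : Parity) (lam : ℝ) : ℝ → ℝ × ℝ := w.sol (initVal j) (unitSlope j) lam

theorem phi_eq (j : Parity) (lam : ℝ) {x : ℝ} (hx : x ∈ Set.Icc (-w.h) w.h) :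
    w.phi j lam x = scale j lam * (w.psi j lam x).1 ∧
      w.phi' j lam x = scale j lam * (w.psi j lam x).2 := by
  have h1 : w.IsSolution lam (initVal j) (initSlope j lam)
      (fun x => scale j lam * (w.psi j lam x).1) fun x => scale j lam * (w.psi j lam x).2 := by
    have h := w.isSolution_sol (initVal j) (unitSlope j) lam
    refine ⟨continuousOn_const.mul h.continuousOn, continuousOn_const.mul h.continuousOn',
      fun x hx => ?_, fun x hx => ?_⟩
    · have := h.eq x hx
      rw [intervalIntegral.integral_const_mul, psi, this]
      cases j <;> simp [scale, initVal]
    · have := h.eq' x hx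
      simp only [mul_left_comm _ (scale j lam)]
      rw [intervalIntegral.integral_const_mul, psi, this]
      cases j <;> simp [scale, initSlope, unitSlope, mul_add]
  have h2 := (w.isSolution_phi j lam).eqOn h1
  exact ⟨h2.1 hx, h2.2 hx⟩

theorem psi_neg (j : Parity) (lam x : ℝ) :
    (w.psi j lam (-x)).1 = sign j * (w.psi j lam x).1 ∧
      (w.psi j lam (-x)).2 = -sign j * (w.psi j lam x).2 := by
  have hs : sign j * sign j = 1 := by cases j <;> simp [sign]
  have hc := w.continuous_sol (initVal j) (unitSlope j) lam
  have hc' : Continuous fun x => w.psi j lam (-x) := hc.comp continuous_neg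
  have := w.eq_sol (α := initVal j) (β := unitSlope j) (lam := lam)
    (φ := fun x => sign j * (w.psi j lam (-x)).1) (φ' := fun x => -sign j * (w.psi j lam (-x)).2)
    (continuous_const.mul hc'.fst) (continuous_const.mul hc'.snd) (fun x => by
      rw [intervalIntegral.integral_const_mul,
        intervalIntegral.integral_comp_neg (fun t => (w.psi j lam t).2), psi, sol_fst_eq,
        neg_zero, intervalIntegral.integral_symm (-x) 0]
      cases j <;> simp [sign, initVal]) (fun x => by
      have : ∀ t, (w.q t - lam) * (sign j * (w.psi j lam (-t)).1) =
          sign j * ((w.q (-t) - lam) * (w.psi j lam (-t)).1) := fun t => by rw [q_neg]; ring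
      simp only [this]
      rw [intervalIntegral.integral_const_mul, intervalIntegral.integral_comp_neg
        (fun t => (w.q t - lam) * (w.psi j lam t).1), psi, sol_snd_eq,
        neg_zero, intervalIntegral.integral_symm (-x) 0]
      cases j <;> simp [sign, unitSlope]) x
  change _ = (w.psi j lam x).1 ∧ _ = (w.psi j lam x).2 at this
  rw [← this.1, ← this.2]
  constructor
  · rw [← mul_assoc, hs, one_mul]
  · linear_combination (-(w.psi j lam (-x)).2) * hs

theorem continuous_psi (j : Parity) : Continuous fun p : ℝ × ℝ => w.psi j p.2 p.1 :=
  w.continuous_sol_uncurry (initVal j) (unitSlope j)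

theorem continuous_psi_left (j : Parity) (lam : ℝ) : Continuous (w.psi j lam) :=
  w.continuous_sol (initVal j) (unitSlope j) lam

theorem continuous_psi_right (j : Parity) (x : ℝ) : Continuous fun lam => w.psi j lam x :=
  Continuous.comp' (g := fun p : ℝ × ℝ => w.psi j p.2 p.1) (w.continuous_psi j)
    (Continuous.prodMk_right x)

end Waveguide

/-! ### Energy and Wronskian identities -/

/-- Backward Grönwall inequality in integral form. -/
theorem le_exp_mul_of_le_add_integral {E : ℝ → ℝ} (hE : Continuous E) {c h : ℝ} (hc : 0 ≤ c)
    (hle : ∀ x ≤ h, E x ≤ E h + c * ∫ t in x..h, E t) {x : ℝ} (hx : x ≤ h) :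
    E x ≤ Real.exp (c * (h - x)) * E h := by
  set U : ℝ → ℝ := fun x => E h + c * ∫ t in x..h, E t with hU
  have hd : ∀ x, HasDerivAt (fun x => Real.exp (c * x) * U x)
      (Real.exp (c * x) * (c * (U x - E x))) x := by
    intro x
    have h1 : HasDerivAt (fun x => ∫ t in x..h, E t) (-E x) x :=
      intervalIntegral.integral_hasDerivAt_left (hE.intervalIntegrable _ _)
        hE.stronglyMeasurable.stronglyMeasurableAtFilter hE.continuousAt
    have h2 : HasDerivAt U (c * -E x) x := (h1.const_mul c).const_add _
    have h3 : HasDerivAt (fun x => Real.exp (c * x)) (Real.exp (c * x) * (c * 1)) x :=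
      ((hasDerivAt_id x).const_mul c).exp
    refine (h3.mul h2).congr_deriv ?_
    ring
  have hmono : MonotoneOn (fun x => Real.exp (c * x) * U x) (Set.Iic h) := by
    refine monotoneOn_of_deriv_nonneg (convex_Iic h)
      (fun x _ => (hd x).continuousAt.continuousWithinAt)
      (fun x _ => (hd x).differentiableAt.differentiableWithinAt) fun x hx' => ?_
    rw [(hd x).deriv]
    have hxh : x ∈ Set.Iic h := interior_subset hx'
    have := hle x hxh
    exact mul_nonneg (Real.exp_pos _).le (mul_nonneg hc (sub_nonneg.2 this))
  have h4 := hmono hx (Set.mem_Iic.2 le_rfl) hx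
  simp only [hU, intervalIntegral.integral_same, mul_zero, add_zero] at h4
  have h5 : Real.exp (c * (h - x)) * Real.exp (c * x) = Real.exp (c * h) := by
    rw [← Real.exp_add]
    ring_nf
  have h6 : Real.exp (c * x) * E x ≤ Real.exp (c * x) * (Real.exp (c * (h - x)) * E h) := by
    calc Real.exp (c * x) * E x ≤ Real.exp (c * x) * (E h + c * ∫ t in x..h, E t) :=
          mul_le_mul_of_nonneg_left (hle x hx) (Real.exp_pos _).le
      _ ≤ Real.exp (c * h) * E h := h4
      _ = _ := by rw [← h5]; ring
  exact le_of_mul_le_mul_left h6 (Real.exp_pos _)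

namespace Waveguide

variable (w : Waveguide)

theorem psi_fst_eq (j : Parity) (lam x : ℝ) :
    (w.psi j lam x).1 = initVal j + ∫ t in (0 : ℝ)..x, (w.psi j lam t).2 :=
  w.sol_fst_eq _ _ lam x

theorem psi_snd_eq (j : Parity) (lam x : ℝ) :
    (w.psi j lam x).2 = unitSlope j + ∫ t in (0 : ℝ)..x, (w.q t - lam) * (w.psi j lam t).1 :=
  w.sol_snd_eq _ _ lam x

theorem psi_zero (j : Parity) (lam : ℝ) : w.psi j lam 0 = (initVal j, unitSlope j) := by
  refine Prod.ext ?_ ?_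
  · simpa using w.psi_fst_eq j lam 0
  · simpa using w.psi_snd_eq j lam 0

theorem wronskian_eq (j : Parity) (l₁ l₂ x : ℝ) :
    (w.psi j l₁ x).1 * (w.psi j l₂ x).2 - (w.psi j l₁ x).2 * (w.psi j l₂ x).1 =
      (l₁ - l₂) * ∫ t in (0 : ℝ)..x, (w.psi j l₁ t).1 * (w.psi j l₂ t).1 := by
  have c : ∀ l, Continuous (w.psi j l) := w.continuous_psi_left j
  have i1 : ∀ l a b, IntervalIntegrable (fun t => (w.psi j l t).2) volume a b :=
    fun l a b => (c l).snd.intervalIntegrable a b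
  have i2 : ∀ l a b, IntervalIntegrable (fun t => (w.q t - l) * (w.psi j l t).1) volume a b :=
    fun l a b => w.intervalIntegrable_q_sub_mul (c l).fst l a b
  have key : ∀ l l', IntervalIntegrable (fun t => (w.psi j l t).2 * (w.psi j l' t).2 +
      (w.psi j l t).1 * ((w.q t - l') * (w.psi j l' t).1)) volume 0 x := fun l l' =>
    (((c l).snd.mul (c l').snd).intervalIntegrable _ _).add
      ((i2 l' 0 x).continuousOn_mul (c l).fst.continuousOn)
  have e := fun l l' => integral_mul_add_mul_of_primitive (i1 l) (i2 l') (w.psi_fst_eq j l)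
    (w.psi_snd_eq j l') 0 x
  have e1 := e l₁ l₂
  have e2 := e l₂ l₁
  rw [w.psi_zero, w.psi_zero] at e1 e2
  have e3 := intervalIntegral.integral_sub (key l₁ l₂) (key l₂ l₁)
  rw [e1, e2] at e3
  have e4 : ∀ t, (w.psi j l₁ t).2 * (w.psi j l₂ t).2 +
      (w.psi j l₁ t).1 * ((w.q t - l₂) * (w.psi j l₂ t).1) - ((w.psi j l₂ t).2 * (w.psi j l₁ t).2 +
      (w.psi j l₂ t).1 * ((w.q t - l₁) * (w.psi j l₁ t).1)) =
      (l₁ - l₂) * ((w.psi j l₁ t).1 * (w.psi j l₂ t).1) := fun t => by ring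
  simp only [e4] at e3
  rw [intervalIntegral.integral_const_mul] at e3
  rw [e3]
  ring

/-- The weighted energy `m² ψ² + ψ'²` grows at most exponentially away from `h`, at a rate which
stays bounded as `lam → ∞` provided `m² - lam` stays bounded. -/
theorem energy_le (j : Parity) {lam m c h x : ℝ} (hc : 0 ≤ c)
    (hq : ∀ t, |w.q t - lam + m ^ 2| ≤ c * m) (hx : x ≤ h) :
    m ^ 2 * (w.psi j lam x).1 ^ 2 + (w.psi j lam x).2 ^ 2 ≤ Real.exp (c * (h - x)) *
      (m ^ 2 * (w.psi j lam h).1 ^ 2 + (w.psi j lam h).2 ^ 2) := by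
  have cψ := w.continuous_psi_left j lam
  have i1 : ∀ a b, IntervalIntegrable (fun t => (w.psi j lam t).2) volume a b :=
    fun a b => cψ.snd.intervalIntegrable a b
  have i2 : ∀ a b, IntervalIntegrable (fun t => (w.q t - lam) * (w.psi j lam t).1) volume a b :=
    fun a b => w.intervalIntegrable_q_sub_mul cψ.fst lam a b
  have hcont : Continuous fun x => m ^ 2 * (w.psi j lam x).1 ^ 2 + (w.psi j lam x).2 ^ 2 :=
    (continuous_const.mul (cψ.fst.pow 2)).add (cψ.snd.pow 2)
  refine le_exp_mul_of_le_add_integral hcont hc (fun x hx => ?_) hx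
  have e1 := integral_mul_add_mul_of_primitive i1 i1 (w.psi_fst_eq j lam) (w.psi_fst_eq j lam) x h
  have e2 := integral_mul_add_mul_of_primitive i2 i2 (w.psi_snd_eq j lam) (w.psi_snd_eq j lam) x h
  have j1 : IntervalIntegrable (fun t => (w.psi j lam t).2 * (w.psi j lam t).1 +
      (w.psi j lam t).1 * (w.psi j lam t).2) volume x h :=
    ((cψ.snd.mul cψ.fst).add (cψ.fst.mul cψ.snd)).intervalIntegrable _ _
  have j2 : IntervalIntegrable (fun t => (w.q t - lam) * (w.psi j lam t).1 * (w.psi j lam t).2 +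
      (w.psi j lam t).2 * ((w.q t - lam) * (w.psi j lam t).1)) volume x h :=
    ((i2 x h).mul_continuousOn cψ.snd.continuousOn).add
      ((i2 x h).continuousOn_mul cψ.snd.continuousOn)
  have e3 := intervalIntegral.integral_add (j1.const_mul (m ^ 2)) j2
  rw [intervalIntegral.integral_const_mul, e1, e2] at e3
  have e4 : -(c * ∫ t in x..h, (m ^ 2 * (w.psi j lam t).1 ^ 2 + (w.psi j lam t).2 ^ 2)) ≤
      ∫ t in x..h, (m ^ 2 * ((w.psi j lam t).2 * (w.psi j lam t).1 +
        (w.psi j lam t).1 * (w.psi j lam t).2) +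
        ((w.q t - lam) * (w.psi j lam t).1 * (w.psi j lam t).2 +
        (w.psi j lam t).2 * ((w.q t - lam) * (w.psi j lam t).1))) := by
    rw [← neg_mul, ← intervalIntegral.integral_const_mul]
    refine intervalIntegral.integral_mono_on hx
      ((continuous_const.mul hcont).intervalIntegrable _ _) ((j1.const_mul (m ^ 2)).add j2)
      fun t _ => ?_
    set p := (w.psi j lam t).1
    set p' := (w.psi j lam t).2
    have h1 : m ^ 2 * (p' * p + p * p') + ((w.q t - lam) * p * p' + p' * ((w.q t - lam) * p)) =
        2 * ((w.q t - lam + m ^ 2) * (p * p')) := by ring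
    have h2 : |(w.q t - lam + m ^ 2) * (p * p')| ≤ c * m * |p * p'| := by
      rw [abs_mul]
      exact mul_le_mul_of_nonneg_right (hq t) (abs_nonneg _)
    have h3 : 2 * (m * |p * p'|) ≤ m ^ 2 * p ^ 2 + p' ^ 2 := by
      rw [abs_mul]
      nlinarith [sq_nonneg (m * |p| - |p'|), sq_abs p, sq_abs p']
    have h4 := neg_abs_le ((w.q t - lam + m ^ 2) * (p * p'))
    have h5 := mul_le_mul_of_nonneg_left h3 hc
    rw [h1]
    nlinarith
  rw [e3] at e4
  nlinarith

/-- The Cauchy data of a nontrivial solution do not vanish. -/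
theorem psi_ne_zero (j : Parity) (lam : ℝ) {h : ℝ} (hh : 0 ≤ h) : w.psi j lam h ≠ 0 := by
  intro h0
  obtain ⟨K, hK⟩ := w.exists_abs_q_le
  have hK0 : 0 ≤ K := (abs_nonneg _).trans (hK 0)
  have := w.energy_le j (lam := lam) (m := 1) (c := K + |lam| + 1) (by positivity)
    (fun t => by
      have h1 := abs_le.1 (hK t)
      have h2 := neg_abs_le lam
      have h3 := le_abs_self lam
      rw [abs_le]
      constructor <;> linarith) hh
  rw [h0, w.psi_zero] at this
  cases j <;> norm_num [initVal, unitSlope] at this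

/-! ### Finiteness of the set of guided modes -/

theorem sqrt_mul_psi_add_psi_eq_zero {j : Parity} {lam : ℝ} (hl : lam ∈ w.guidedEigenvalues j) :
    √(w.dSq - lam) * (w.psi j lam w.h).1 + (w.psi j lam w.h).2 = 0 := by
  obtain ⟨h0, -, h1⟩ := hl
  have hmem : w.h ∈ Set.Icc (-w.h) w.h := ⟨by linarith [w.h_pos], le_rfl⟩
  rw [(w.phi_eq j lam hmem).1, (w.phi_eq j lam hmem).2, mul_left_comm, ← mul_add] at h1
  refine (mul_eq_zero.1 h1).resolve_left ?_
  cases j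
  · exact one_ne_zero
  · exact (Real.sqrt_pos.2 h0).ne'

/-- Orthogonality of the guided modes, written on the half core: the right hand side is minus the
integral of the product of the two exponential tails. -/
theorem integral_psi_mul_psi_eq {j : Parity} {l₁ l₂ : ℝ} (h₁ : l₁ ∈ w.guidedEigenvalues j)
    (h₂ : l₂ ∈ w.guidedEigenvalues j) (hne : l₁ ≠ l₂) :
    (√(w.dSq - l₁) + √(w.dSq - l₂)) * ∫ t in (0 : ℝ)..w.h, (w.psi j l₁ t).1 * (w.psi j l₂ t).1 =
      -((w.psi j l₁ w.h).1 * (w.psi j l₂ w.h).1) := by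
  have e1 := w.sqrt_mul_psi_add_psi_eq_zero h₁
  have e2 := w.sqrt_mul_psi_add_psi_eq_zero h₂
  have e3 := w.wronskian_eq j l₁ l₂ w.h
  have q1 : √(w.dSq - l₁) ^ 2 = w.dSq - l₁ := Real.sq_sqrt (by linarith [h₁.2.1])
  have q2 : √(w.dSq - l₂) ^ 2 = w.dSq - l₂ := Real.sq_sqrt (by linarith [h₂.2.1])
  set s₁ := √(w.dSq - l₁)
  set s₂ := √(w.dSq - l₂)
  have hs : s₂ - s₁ ≠ 0 := by
    intro h
    apply hne
    have : s₁ = s₂ := by linarith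
    rw [this] at q1
    linarith
  have hl : l₁ - l₂ = (s₂ - s₁) * (s₁ + s₂) := by linear_combination q1 - q2
  rw [hl, mul_assoc] at e3
  refine mul_left_cancel₀ hs ?_
  rw [← e3]
  linear_combination (w.psi j l₁ w.h).1 * e2 - (w.psi j l₂ w.h).1 * e1

/-- Eigenvalues do not accumulate: for two distinct eigenvalues near `l₀` the product of the modes
would have a positive integral, as the modes are close to each other, contrary to orthogonality. -/
theorem eventually_eq_of_mem_guidedEigenvalues (j : Parity) (l₀ : ℝ) :
    ∀ᶠ p in nhds l₀ ×ˢ nhds l₀, p.1 ∈ w.guidedEigenvalues j → p.2 ∈ w.guidedEigenvalues j →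
      p.1 = p.2 := by
  have hψ := w.continuous_psi_right j w.h
  by_cases h0 : (w.psi j l₀ w.h).1 = 0
  · have h1 : (w.psi j l₀ w.h).2 ≠ 0 := fun h1 => w.psi_ne_zero j l₀ w.h_pos.le (Prod.ext h0 h1)
    have hc : Continuous fun l => √(w.dSq - l) * (w.psi j l w.h).1 + (w.psi j l w.h).2 :=
      ((continuous_const.sub continuous_id).sqrt.mul hψ.fst).add hψ.snd
    have h2 : ∀ᶠ l in nhds l₀, √(w.dSq - l) * (w.psi j l w.h).1 + (w.psi j l w.h).2 ≠ 0 :=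
      hc.continuousAt.eventually_ne (by simpa [h0] using h1)
    filter_upwards [h2.prod_inl _] with p hp hp1
    exact absurd (w.sqrt_mul_psi_add_psi_eq_zero hp1) hp
  · have hI : Continuous fun p : ℝ × ℝ =>
        ∫ t in (0 : ℝ)..w.h, (w.psi j p.1 t).1 * (w.psi j p.2 t).1 := by
      refine intervalIntegral.continuous_parametric_intervalIntegral_of_continuous' ?_ 0 w.h
      have c1 : Continuous fun x : (ℝ × ℝ) × ℝ => w.psi j x.1.1 x.2 :=
        (w.continuous_psi j).comp' (continuous_snd.prodMk continuous_fst.fst)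
      have c2 : Continuous fun x : (ℝ × ℝ) × ℝ => w.psi j x.1.2 x.2 :=
        (w.continuous_psi j).comp' (continuous_snd.prodMk continuous_fst.snd)
      exact c1.fst.mul c2.fst
    have hI0 : 0 < ∫ t in (0 : ℝ)..w.h, (w.psi j l₀ t).1 * (w.psi j l₀ t).1 := by
      have c1 := (w.continuous_psi_left j l₀).fst
      exact intervalIntegral.integral_pos w.h_pos (c1.mul c1).continuousOn
        (fun x _ => mul_self_nonneg _)
        ⟨w.h, ⟨w.h_pos.le, le_rfl⟩, mul_self_pos.2 h0⟩
    have hP : Continuous fun p : ℝ × ℝ => (w.psi j p.1 w.h).1 * (w.psi j p.2 w.h).1 :=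
      (hψ.comp' continuous_fst).fst.mul (hψ.comp' continuous_snd).fst
    have e1 := (hI.tendsto (l₀, l₀)).eventually_const_lt hI0
    have e2 := (hP.tendsto (l₀, l₀)).eventually_const_lt (mul_self_pos.2 h0)
    rw [nhds_prod_eq] at e1 e2
    filter_upwards [e1, e2] with p hp1 hp2 hm1 hm2
    by_contra hne
    have e := w.integral_psi_mul_psi_eq hm1 hm2 hne
    have h3 := mul_nonneg (add_nonneg (Real.sqrt_nonneg (w.dSq - p.1))
      (Real.sqrt_nonneg (w.dSq - p.2))) hp1.le
    linarith

theorem finite_guidedEigenvalues (j : Parity) : (w.guidedEigenvalues j).Finite := by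
  by_contra hinf
  obtain ⟨l₀, -, hacc⟩ := Set.Infinite.exists_accPt_of_subset_isCompact hinf
    (isCompact_Icc (a := 0) (b := w.dSq)) fun l hl => ⟨hl.1.le, hl.2.1.le⟩
  obtain ⟨U, hU, hUU⟩ := Filter.eventually_prod_self_iff'.1
    (w.eventually_eq_of_mem_guidedEigenvalues j l₀)
  rw [accPt_iff_nhds] at hacc
  obtain ⟨l₁, ⟨hl₁U, hl₁⟩, hne₁⟩ := hacc U hU
  obtain ⟨l₂, ⟨⟨hl₂U, hne₂⟩, hl₂⟩, -⟩ :=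
    hacc (U ∩ {l₁}ᶜ) (Filter.inter_mem hU (isOpen_compl_singleton.mem_nhds (Ne.symm hne₁)))
  exact hne₂ (hUU l₂ hl₂U l₁ hl₁U hl₂ hl₁)

/-! ### The spectral density controls the generalized eigenfunctions -/

/-- The constant does not depend on `x` and `lam`: outside of the core
`v_j² ≤ φ_j(h)² + (φ_j'(h) / Q)² = 1 / (Q σ_j)`, and inside of it the energy estimate, with weight
`m = max(1, Q)`, bounds `v_j²` by a multiple of its outer counterpart. -/
theorem exists_sq_v_mul_sigma_le (j : Parity) : ∃ C : ℝ, 0 ≤ C ∧ ∀ x lam, w.dSq < lam →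
    w.v j x lam ^ 2 * w.sigma j lam ≤ C / √(lam - w.dSq) := by
  obtain ⟨K, hK⟩ := w.exists_abs_q_le
  have hK0 : 0 ≤ K := (abs_nonneg _).trans (hK 0)
  set c := K + |w.dSq| + 1 with hcdef
  have hc : 0 ≤ c := by positivity
  have hhp := w.h_pos
  have hexp : 1 ≤ Real.exp (c * w.h) := Real.one_le_exp (by positivity)
  refine ⟨Real.exp (c * w.h), (Real.exp_pos _).le, fun x lam hlam => ?_⟩
  have hmem : w.h ∈ Set.Icc (-w.h) w.h := ⟨by linarith, le_rfl⟩
  have hmem' : -w.h ∈ Set.Icc (-w.h) w.h := ⟨le_rfl, by linarith⟩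
  set Q := √(lam - w.dSq) with hQ
  have hQ0 : 0 < Q := Real.sqrt_pos.2 (by linarith)
  have hQ2 : Q ^ 2 = lam - w.dSq := Real.sq_sqrt (by linarith)
  set a := w.phi j lam w.h with ha
  set b := w.phi' j lam w.h with hb
  have key : w.v j x lam ^ 2 ≤ Real.exp (c * w.h) * (a ^ 2 + b ^ 2 / Q ^ 2) := by
    have hpos : 0 ≤ a ^ 2 + b ^ 2 / Q ^ 2 := by positivity
    -- `a cos θ + (b / Q) sin θ` is the projection of `(a, b / Q)` on a unit vector
    have trig : ∀ a' b' θ : ℝ, a' ^ 2 = a ^ 2 → b' ^ 2 = b ^ 2 →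
        (a' * Real.cos θ + b' / Q * Real.sin θ) ^ 2 ≤
          Real.exp (c * w.h) * (a ^ 2 + b ^ 2 / Q ^ 2) := by
      intro a' b' θ ha' hb'
      have h1 : (a' * Real.cos θ + b' / Q * Real.sin θ) ^ 2 ≤ a' ^ 2 + (b' / Q) ^ 2 := by
        have := Real.sin_sq_add_cos_sq θ
        have h2 : a' ^ 2 + (b' / Q) ^ 2 = (a' * Real.cos θ + b' / Q * Real.sin θ) ^ 2 +
            (a' * Real.sin θ - b' / Q * Real.cos θ) ^ 2 := by
          linear_combination (-(a' ^ 2 + (b' / Q) ^ 2)) * this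
        rw [h2]
        exact le_add_of_nonneg_right (sq_nonneg _)
      rw [div_pow, ha', hb'] at h1
      exact h1.trans (le_mul_of_one_le_left hpos hexp)
    have hnegs : w.phi j lam (-w.h) ^ 2 = a ^ 2 ∧ w.phi' j lam (-w.h) ^ 2 = b ^ 2 := by
      rw [ha, hb, (w.phi_eq j lam hmem').1, (w.phi_eq j lam hmem').2, (w.phi_eq j lam hmem).1,
        (w.phi_eq j lam hmem).2, (w.psi_neg j lam w.h).1, (w.psi_neg j lam w.h).2]
      cases j <;> simp [sign]
    unfold v
    split_ifs with hx hxh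
    · have hxm : x ∈ Set.Icc (-w.h) w.h := abs_le.1 hx
      rw [(w.phi_eq j lam hxm).1]
      have habs : (w.psi j lam x).1 ^ 2 = (w.psi j lam |x|).1 ^ 2 := by
        rcases abs_choice x with h | h
        · rw [h]
        · rw [h, (w.psi_neg j lam x).1]
          cases j <;> simp [sign]
      set m := max 1 Q with hm
      have hm1 : 1 ≤ m := le_max_left _ _
      have hmQ : Q ≤ m := le_max_right _ _
      have hm0 : 0 < m := by linarith
      have hen := w.energy_le j (lam := lam) (m := m) (c := c) (h := w.h) (x := |x|) hc
        (fun t => by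
          have h1 := abs_le.1 (hK t)
          have h2 := neg_abs_le w.dSq
          have h3 := le_abs_self w.dSq
          have h4 : c ≤ c * m := le_mul_of_one_le_right hc hm1
          refine le_trans ?_ h4
          -- `m² - lam` differs from `-d²` by at most `1`
          have h5 : 0 ≤ m ^ 2 - Q ^ 2 ∧ m ^ 2 - Q ^ 2 ≤ 1 := by
            rcases le_total 1 Q with h | h
            · rw [hm, max_eq_right h]; simp
            · rw [hm, max_eq_left h]
              constructor <;> nlinarith
          rw [abs_le, hcdef]
          constructor <;> linarith [h5.1, h5.2]) hx
      have hexp' : Real.exp (c * (w.h - |x|)) ≤ Real.exp (c * w.h) := by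
        apply Real.exp_le_exp.2
        exact mul_le_mul_of_nonneg_left (by linarith [abs_nonneg x]) hc
      have ha2 : a = scale j lam * (w.psi j lam w.h).1 := (w.phi_eq j lam hmem).1
      have hb2 : b = scale j lam * (w.psi j lam w.h).2 := (w.phi_eq j lam hmem).2
      rw [mul_pow, habs]
      have h1 : m ^ 2 * (scale j lam ^ 2 * (w.psi j lam |x|).1 ^ 2) ≤
          Real.exp (c * w.h) * (m ^ 2 * a ^ 2 + b ^ 2) := by
        have h2 : m ^ 2 * (w.psi j lam |x|).1 ^ 2 ≤ Real.exp (c * w.h) *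
            (m ^ 2 * (w.psi j lam w.h).1 ^ 2 + (w.psi j lam w.h).2 ^ 2) :=
          (le_add_of_nonneg_right (sq_nonneg _)).trans
            (hen.trans (mul_le_mul_of_nonneg_right hexp' (by positivity)))
        have h3 := mul_le_mul_of_nonneg_left h2 (sq_nonneg (scale j lam))
        rw [ha2, hb2]
        linarith
      have h4 : m ^ 2 * a ^ 2 + b ^ 2 ≤ m ^ 2 * (a ^ 2 + b ^ 2 / Q ^ 2) := by
        have h5 : Q ^ 2 ≤ m ^ 2 := pow_le_pow_left₀ hQ0.le hmQ 2
        have h6 : b ^ 2 = Q ^ 2 * (b ^ 2 / Q ^ 2) := by field_simp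
        have h7 : Q ^ 2 * (b ^ 2 / Q ^ 2) ≤ m ^ 2 * (b ^ 2 / Q ^ 2) :=
          mul_le_mul_of_nonneg_right h5 (by positivity)
        linarith
      have h8 := h1.trans (mul_le_mul_of_nonneg_left h4 (Real.exp_pos _).le)
      rw [mul_left_comm (Real.exp _)] at h8
      exact le_of_mul_le_mul_left h8 (by positivity)
    · exact trig _ _ _ rfl rfl
    · exact trig _ _ _ hnegs.1 hnegs.2
  have hσ : w.sigma j lam = Q / (Q ^ 2 * a ^ 2 + b ^ 2) := by rw [sigma, hQ2]
  have hσ0 : 0 ≤ w.sigma j lam := by rw [hσ]; positivity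
  refine (mul_le_mul_of_nonneg_right key hσ0).trans ?_
  rw [mul_assoc, div_eq_mul_one_div (Real.exp _)]
  refine mul_le_mul_of_nonneg_left ?_ (Real.exp_pos _).le
  rw [hσ]
  -- were the denominator of `σ` zero, then `σ = 0` and the bound would be trivial
  rcases eq_or_ne (Q ^ 2 * a ^ 2 + b ^ 2) 0 with h | h
  · rw [h, div_zero, mul_zero]
    positivity
  · refine le_of_eq ?_
    have h' : a ^ 2 + b ^ 2 / Q ^ 2 = (Q ^ 2 * a ^ 2 + b ^ 2) / Q ^ 2 := by field_simp
    rw [h']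
    generalize Q ^ 2 * a ^ 2 + b ^ 2 = D at h
    field_simp

theorem sigma_nonneg (j : Parity) {lam : ℝ} (hlam : w.dSq < lam) : 0 ≤ w.sigma j lam := by
  have : 0 < lam - w.dSq := by linarith
  unfold sigma
  positivity

theorem exists_abs_v_mul_v_mul_sigma_le (j : Parity) : ∃ C : ℝ, 0 ≤ C ∧ ∀ x ξ lam, w.dSq < lam →
    |w.v j x lam| * |w.v j ξ lam| * w.sigma j lam ≤ C / √(lam - w.dSq) := by
  obtain ⟨C, hC, h⟩ := w.exists_sq_v_mul_sigma_le j
  refine ⟨C, hC, fun x ξ lam hlam => ?_⟩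
  have h1 := h x lam hlam
  have h2 := h ξ lam hlam
  have h3 : |w.v j x lam| * |w.v j ξ lam| ≤ (w.v j x lam ^ 2 + w.v j ξ lam ^ 2) / 2 := by
    nlinarith [sq_nonneg (|w.v j x lam| - |w.v j ξ lam|), sq_abs (w.v j x lam),
      sq_abs (w.v j ξ lam)]
  have h4 := mul_le_mul_of_nonneg_right h3 (w.sigma_nonneg j hlam)
  linarith

end Waveguide

/-! ### Bounds for the integrand of the Green's function -/

theorem exp_neg_le_rpow {y : ℝ} (hy : 0 < y) : Real.exp (-y) ≤ y ^ (-(1 / 4) : ℝ) := by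
  rw [Real.rpow_def_of_pos hy]
  apply Real.exp_le_exp.2
  linarith [Real.log_le_sub_one_of_pos hy]

namespace Waveguide

variable (w : Waveguide)

theorem dSq_lt_kappaSq : w.dSq < w.kappaSq := by
  have := mul_pos (pow_pos w.k_pos 2) (pow_pos w.nCl_pos 2)
  unfold dSq kappaSq
  linarith

/-- An integrable function on `(d², ∞)` which, up to a constant depending on `z - ζ`, dominates the
integrand of the radiation and evanescent parts. The exponent `5/8 = 1/2 + 1/8` results from
trading `1/8` of integrability at `k² n_*²` for decay at infinity, by means of
`e^{-ts} ≤ (ts)^{-1/4}`. -/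
noncomputable def majorant (lam : ℝ) : ℝ :=
  if lam < w.kappaSq then (w.kappaSq - lam) ^ (-(1 / 2) : ℝ) + (lam - w.dSq) ^ (-(1 / 2) : ℝ)
  else if lam ≤ w.kappaSq + 1 then (lam - w.kappaSq) ^ (-(5 / 8) : ℝ)
  else (lam - w.kappaSq) ^ (-(9 / 8) : ℝ)

theorem majorant_nonneg {lam : ℝ} (hlam : w.dSq < lam) : 0 ≤ w.majorant lam := by
  have h0 : 0 ≤ lam - w.dSq := by linarith
  unfold majorant
  split_ifs with h1 h2
  · have : 0 ≤ w.kappaSq - lam := by linarith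
    positivity
  · have : 0 ≤ lam - w.kappaSq := by linarith
    positivity
  · have : 0 ≤ lam - w.kappaSq := by linarith
    positivity

theorem integrableOn_majorant : IntegrableOn w.majorant (Set.Ioi w.dSq) := by
  have hd := w.dSq_lt_kappaSq
  set κ := w.kappaSq
  set d := w.dSq
  have hs : Set.Ioi d = (Set.Ioo d κ ∪ Set.Icc κ (κ + 1)) ∪ Set.Ioi (κ + 1) := by
    rw [Set.Ioo_union_Icc_eq_Ioc hd (by linarith), Set.Ioc_union_Ioi_eq_Ioi (by linarith)]
  rw [hs]
  refine (IntegrableOn.union ?_ ?_).union ?_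
  · have h1 : IntervalIntegrable (fun x : ℝ => x ^ (-(1 / 2) : ℝ)) volume 0 (κ - d) :=
      intervalIntegral.intervalIntegrable_rpow' (by norm_num)
    have h2 := (h1.comp_sub_right d).1
    have h3 := (h1.comp_sub_left κ).2
    simp only [zero_add, sub_add_cancel, sub_zero, sub_sub_cancel] at h2 h3
    refine IntegrableOn.congr_fun ((h3.add h2).mono_set Set.Ioo_subset_Ioc_self)
      (fun x hx => ?_) measurableSet_Ioo
    rw [majorant, if_pos hx.2]
    rfl
  · have h1 : IntervalIntegrable (fun x : ℝ => x ^ (-(5 / 8) : ℝ)) volume 0 1 :=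
      intervalIntegral.intervalIntegrable_rpow' (by norm_num)
    have h2 := (h1.comp_sub_right κ).1
    simp only [zero_add, add_comm 1 κ] at h2
    rw [integrableOn_Icc_iff_integrableOn_Ioc]
    refine h2.congr_fun (fun x hx => ?_) measurableSet_Ioc
    rw [majorant, if_neg (not_lt.2 hx.1.le), if_pos hx.2]
  · have h1 : IntegrableOn (fun x : ℝ => x ^ (-(9 / 8) : ℝ)) (Set.Ioi 1) :=
      integrableOn_Ioi_rpow_of_lt (by norm_num) one_pos
    have h2 : IntegrableOn (fun x : ℝ => (x - κ) ^ (-(9 / 8) : ℝ)) (Set.Ioi (κ + 1)) := by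
      have := ((measurePreserving_sub_right volume κ).integrableOn_comp_preimage
        (measurableEmbedding_subRight κ)).2 h1
      simpa [Function.comp_def, add_comm] using this
    refine h2.congr_fun (fun x hx => ?_) measurableSet_Ioi
    have hx' : κ + 1 < x := hx
    rw [majorant, if_neg (not_lt.2 (by linarith)), if_neg (not_le.2 hx')]

theorem norm_modeKernel_of_lt (j : Parity) (p p' : ℝ × ℝ) {lam : ℝ} (hlam : lam < w.kappaSq) :
    ‖w.modeKernel j p p' lam‖ =
      1 / (2 * √(w.kappaSq - lam)) * (|w.v j p.1 lam| * |w.v j p'.1 lam|) := by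
  rw [modeKernel, axialRoot, if_pos hlam.le]
  simp only [norm_mul, norm_div, Complex.norm_exp, Complex.norm_I, Complex.norm_real,
    Real.norm_eq_abs, Complex.norm_ofNat, abs_of_nonneg (Real.sqrt_nonneg _)]
  simp [mul_assoc]

theorem norm_modeKernel_of_gt (j : Parity) (p p' : ℝ × ℝ) {lam : ℝ} (hlam : w.kappaSq < lam) :
    ‖w.modeKernel j p p' lam‖ =
      Real.exp (-(|p.2 - p'.2| * √(lam - w.kappaSq))) / (2 * √(lam - w.kappaSq)) *
        (|w.v j p.1 lam| * |w.v j p'.1 lam|) := by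
  rw [modeKernel, axialRoot, if_neg (not_le.2 hlam)]
  simp only [norm_mul, norm_div, Complex.norm_exp, Complex.norm_I, Complex.norm_real,
    Real.norm_eq_abs, Complex.norm_ofNat, abs_of_nonneg (Real.sqrt_nonneg _)]
  simp [mul_assoc]

/-- Products of inverse square roots are controlled by their sum, the sum of the arguments being
fixed. -/
theorem one_div_sqrt_mul_sqrt_le {a b : ℝ} (ha : 0 < a) (hb : 0 < b) :
    1 / √a * (1 / √b) ≤ 1 / √(a + b) * (a ^ (-(1 / 2) : ℝ) + b ^ (-(1 / 2) : ℝ)) := by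
  have e : ∀ {x : ℝ}, 0 < x → x ^ (-(1 / 2) : ℝ) = 1 / √x := fun {x} hx => by
    rw [Real.rpow_neg hx.le, ← Real.sqrt_eq_rpow, one_div (√x)]
  rw [e ha, e hb]
  have hab : 0 < a + b := add_pos ha hb
  have sa := Real.sqrt_pos.2 ha
  have sb := Real.sqrt_pos.2 hb
  have sab := Real.sqrt_pos.2 hab
  have h1 : √(a + b) ≤ √a + √b := by
    rw [Real.sqrt_le_left (by positivity)]
    nlinarith [Real.sq_sqrt ha.le, Real.sq_sqrt hb.le, mul_pos sa sb]
  have h2 : 1 / √(a + b) * (1 / √a + 1 / √b) = (1 / √a * (1 / √b)) * ((√a + √b) / √(a + b)) := by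
    field_simp
    ring
  rw [h2]
  refine le_mul_of_one_le_right (by positivity) ?_
  rwa [one_le_div sab]

/-- The density of the spectral integral is dominated by an integrable function of `lam`,
uniformly in the transversal variables. -/
theorem exists_norm_modeKernel_mul_sigma_le (j : Parity) : ∃ C : ℝ, 0 ≤ C ∧
    ∀ p p' : ℝ × ℝ, p.2 ≠ p'.2 → ∀ lam, w.dSq < lam →
      ‖w.modeKernel j p p' lam‖ * w.sigma j lam ≤
        C * (1 + |p.2 - p'.2| ^ (-(1 / 4) : ℝ)) * w.majorant lam := by
  obtain ⟨C, hC, hle⟩ := w.exists_abs_v_mul_v_mul_sigma_le j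
  have hd := w.dSq_lt_kappaSq
  have hδ : 0 < w.kappaSq - w.dSq := by linarith
  have hsδ := Real.sqrt_pos.2 hδ
  set D := 1 / √(w.kappaSq - w.dSq) with hD
  have hD0 : 0 ≤ D := by positivity
  -- `D` bounds `1 / √(lam - d²)` above `k² n_*²`
  refine ⟨C * (1 + D), by positivity, fun p p' hp lam hlam => ?_⟩
  have ht : 0 < |p.2 - p'.2| := abs_pos.2 (sub_ne_zero.2 hp)
  set t := |p.2 - p'.2|
  have hT : 0 ≤ t ^ (-(1 / 4) : ℝ) := by positivity
  set T := t ^ (-(1 / 4) : ℝ) with hTdef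
  have hv := hle p.1 p'.1 lam hlam
  have hQ0 : 0 < √(lam - w.dSq) := Real.sqrt_pos.2 (by linarith)
  have hm := w.majorant_nonneg hlam
  rcases lt_trichotomy lam w.kappaSq with h | h | h
  · have hs : 0 < √(w.kappaSq - lam) := Real.sqrt_pos.2 (by linarith)
    rw [w.norm_modeKernel_of_lt j p p' h, mul_assoc]
    have h1 : 1 / √(w.kappaSq - lam) * (1 / √(lam - w.dSq)) ≤ D * w.majorant lam := by
      have := one_div_sqrt_mul_sqrt_le (a := w.kappaSq - lam) (b := lam - w.dSq) (by linarith)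
        (by linarith)
      rw [sub_add_sub_cancel, ← hD] at this
      rw [majorant, if_pos h]
      exact this
    calc 1 / (2 * √(w.kappaSq - lam)) * (|w.v j p.1 lam| * |w.v j p'.1 lam| * w.sigma j lam)
        ≤ 1 / (2 * √(w.kappaSq - lam)) * (C / √(lam - w.dSq)) := by gcongr
      _ = C / 2 * (1 / √(w.kappaSq - lam) * (1 / √(lam - w.dSq))) := by field_simp
      _ ≤ C / 2 * (D * w.majorant lam) := by gcongr
      _ ≤ C * (1 + D) * (1 + T) * w.majorant lam := by
        have h2 : C / 2 * D ≤ C * (1 + D) * (1 + T) := by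
          have : 0 ≤ C * D := by positivity
          have : 0 ≤ C * (1 + D) * T := by positivity
          nlinarith
        rw [← mul_assoc]
        exact mul_le_mul_of_nonneg_right h2 hm
  · -- at `lam = k² n_*²` the kernel is `0` by the convention for division by zero
    have h0 : w.modeKernel j p p' lam = 0 := by
      simp [modeKernel, axialRoot, h]
    rw [h0, norm_zero, zero_mul]
    positivity
  · have hu : 0 < lam - w.kappaSq := by linarith
    have hs : 0 < √(lam - w.kappaSq) := Real.sqrt_pos.2 hu
    have hss : √(lam - w.kappaSq) = (lam - w.kappaSq) ^ (1 / 2 : ℝ) := Real.sqrt_eq_rpow _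
    rw [w.norm_modeKernel_of_gt j p p' h, mul_assoc]
    set u := lam - w.kappaSq with hudef
    have hexp : Real.exp (-(t * √u)) ≤ T * u ^ (-(1 / 8) : ℝ) := by
      refine (exp_neg_le_rpow (mul_pos ht hs)).trans (le_of_eq ?_)
      rw [Real.mul_rpow ht.le hs.le, hss, ← Real.rpow_mul hu.le, hTdef]
      congr 2
      norm_num
    have h58 : u ^ (-(1 / 8) : ℝ) * (1 / √u) = u ^ (-(5 / 8) : ℝ) := by
      rw [hss, one_div (u ^ _), ← Real.rpow_neg hu.le, ← Real.rpow_add hu]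
      norm_num
    have hg : u ^ (-(5 / 8) : ℝ) * (1 / √(lam - w.dSq)) ≤ (1 + D) * w.majorant lam := by
      rw [majorant, if_neg (not_lt.2 h.le), ← hudef]
      split_ifs with h1
      · have h2 : 1 / √(lam - w.dSq) ≤ 1 + D := by
          have : 1 / √(lam - w.dSq) ≤ D :=
            one_div_le_one_div_of_le hsδ (Real.sqrt_le_sqrt (by linarith))
          linarith
        rw [mul_comm (1 + D)]
        gcongr
      · have h2 : 1 / √(lam - w.dSq) ≤ u ^ (-(1 / 2) : ℝ) := by
          rw [Real.rpow_neg hu.le, ← hss, ← one_div]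
          exact one_div_le_one_div_of_le hs (Real.sqrt_le_sqrt (by linarith))
        have h3 : u ^ (-(5 / 8) : ℝ) * u ^ (-(1 / 2) : ℝ) = u ^ (-(9 / 8) : ℝ) := by
          rw [← Real.rpow_add hu]
          norm_num
        calc u ^ (-(5 / 8) : ℝ) * (1 / √(lam - w.dSq))
            ≤ u ^ (-(5 / 8) : ℝ) * u ^ (-(1 / 2) : ℝ) := by gcongr
          _ = u ^ (-(9 / 8) : ℝ) := h3
          _ ≤ (1 + D) * u ^ (-(9 / 8) : ℝ) :=
            le_mul_of_one_le_left (by positivity) (by linarith)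
    have hσ := w.sigma_nonneg j hlam
    calc Real.exp (-(t * √u)) / (2 * √u) * (|w.v j p.1 lam| * |w.v j p'.1 lam| * w.sigma j lam)
        ≤ T * u ^ (-(1 / 8) : ℝ) / (2 * √u) * (C / √(lam - w.dSq)) := by gcongr
      _ = C / 2 * T * ((u ^ (-(1 / 8) : ℝ) * (1 / √u)) * (1 / √(lam - w.dSq))) := by
        field_simp
      _ ≤ C / 2 * T * ((1 + D) * w.majorant lam) := by
        rw [h58]
        gcongr
      _ ≤ C * (1 + D) * (1 + T) * w.majorant lam := by
        have h2 : C / 2 * T * (1 + D) ≤ C * (1 + D) * (1 + T) := by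
          have : 0 ≤ C * (1 + D) * T := by positivity
          have : 0 ≤ C * (1 + D) := by positivity
          nlinarith
        rw [← mul_assoc]
        exact mul_le_mul_of_nonneg_right h2 hm

/-- Guided modes are bounded. -/
theorem exists_abs_v_le (j : Parity) {lam : ℝ} (hlam : lam ≤ w.dSq) :
    ∃ B : ℝ, ∀ x, |w.v j x lam| ≤ B := by
  obtain ⟨M, hM⟩ := isCompact_Icc.exists_bound_of_continuousOn (w.isSolution_phi j lam).continuousOn
  have hh := w.h_pos
  have h1 := hM w.h ⟨by linarith, le_rfl⟩
  have h2 := hM (-w.h) ⟨le_rfl, by linarith⟩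
  have hM0 : 0 ≤ M := (norm_nonneg _).trans h1
  refine ⟨M, fun x => ?_⟩
  unfold v
  rw [if_neg (not_lt.2 hlam)]
  split_ifs with hx hx'
  · exact hM x (abs_le.1 hx)
  · rw [abs_mul, Real.abs_exp, ← mul_one M]
    refine mul_le_mul h1 (Real.exp_le_one_iff.2 ?_) (Real.exp_pos _).le hM0
    rw [neg_mul]
    exact neg_nonpos.2 (mul_nonneg (Real.sqrt_nonneg _) (by linarith))
  · have hx'' : x < -w.h := by
      by_contra h
      exact hx (abs_le.2 ⟨not_lt.1 h, not_lt.1 hx'⟩)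
    rw [abs_mul, Real.abs_exp, ← mul_one M]
    refine mul_le_mul h2 (Real.exp_le_one_iff.2 ?_) (Real.exp_pos _).le hM0
    exact mul_nonpos_of_nonneg_of_nonpos (Real.sqrt_nonneg _) (by linarith)

theorem exists_norm_modeKernel_le (j : Parity) {lam : ℝ} (hlam : lam ≤ w.dSq) :
    ∃ B : ℝ, ∀ p p' : ℝ × ℝ, ‖w.modeKernel j p p' lam‖ ≤ B := by
  obtain ⟨B, hB⟩ := w.exists_abs_v_le j hlam
  have hB0 : 0 ≤ B := (abs_nonneg _).trans (hB 0)
  refine ⟨1 / (2 * √(w.kappaSq - lam)) * (B * B), fun p p' => ?_⟩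
  rw [w.norm_modeKernel_of_lt j p p' (hlam.trans_lt w.dSq_lt_kappaSq)]
  gcongr
  · exact hB _
  · exact hB _

/-! ### Measurability -/

theorem measurable_scale (j : Parity) : Measurable (scale j) := by
  cases j
  · exact measurable_const
  · exact Real.continuous_sqrt.measurable

theorem measurable_phi (j : Parity) {x : ℝ} (hx : x ∈ Set.Icc (-w.h) w.h) :
    (Measurable fun lam => w.phi j lam x) ∧ Measurable fun lam => w.phi' j lam x := by
  simp only [fun lam => (w.phi_eq j lam hx).1, fun lam => (w.phi_eq j lam hx).2]
  have := (w.continuous_psi_right j x).measurable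
  exact ⟨(measurable_scale j).mul this.fst, (measurable_scale j).mul this.snd⟩

theorem measurable_sigma (j : Parity) : Measurable (w.sigma j) := by
  obtain ⟨h1, h2⟩ := w.measurable_phi j (x := w.h) ⟨by linarith [w.h_pos], le_rfl⟩
  unfold sigma
  fun_prop

/-- On the core `φ_j` is replaced by `scale j lam * ψ_j`, as nothing is known about `φ_j(x, lam)` for
`x` outside of the core. -/
theorem measurable_v (j : Parity) : Measurable fun p : ℝ × ℝ => w.v j p.1 p.2 := by
  have hh := w.h_pos
  obtain ⟨h1, h2⟩ := w.measurable_phi j (x := w.h) ⟨by linarith, le_rfl⟩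
  obtain ⟨h3, h4⟩ := w.measurable_phi j (x := -w.h) ⟨le_rfl, by linarith⟩
  have h0 : Measurable fun p : ℝ × ℝ => scale j p.2 * (w.psi j p.2 p.1).1 :=
    ((measurable_scale j).comp measurable_snd).mul (w.continuous_psi j).measurable.fst
  have e : (fun p : ℝ × ℝ => w.v j p.1 p.2) = fun p : ℝ × ℝ =>
      if |p.1| ≤ w.h then scale j p.2 * (w.psi j p.2 p.1).1 else
      (if ¬ |p.1| ≤ w.h then w.v j p.1 p.2 else 0) := by
    funext p
    split_ifs with h
    · rw [v, if_pos h, (w.phi_eq j p.2 (abs_le.1 h)).1]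
    · rfl
  have m1 : MeasurableSet {p : ℝ × ℝ | |p.1| ≤ w.h} :=
    measurableSet_le (by fun_prop) measurable_const
  rw [e]
  refine Measurable.ite m1 h0 ?_
  have e2 : (fun p : ℝ × ℝ => if ¬ |p.1| ≤ w.h then w.v j p.1 p.2 else 0) = fun p : ℝ × ℝ =>
      if |p.1| ≤ w.h then 0 else if w.dSq < p.2 then
        (if w.h < p.1 then
          w.phi j p.2 w.h * Real.cos (√(p.2 - w.dSq) * (p.1 - w.h)) +
            w.phi' j p.2 w.h / √(p.2 - w.dSq) * Real.sin (√(p.2 - w.dSq) * (p.1 - w.h))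
        else w.phi j p.2 (-w.h) * Real.cos (√(p.2 - w.dSq) * (p.1 + w.h)) +
            w.phi' j p.2 (-w.h) / √(p.2 - w.dSq) * Real.sin (√(p.2 - w.dSq) * (p.1 + w.h)))
      else (if w.h < p.1 then w.phi j p.2 w.h * Real.exp (-√(w.dSq - p.2) * (p.1 - w.h))
        else w.phi j p.2 (-w.h) * Real.exp (√(w.dSq - p.2) * (p.1 + w.h))) := by
    funext p
    by_cases h : |p.1| ≤ w.h
    · simp [h]
    · simp only [v, h, if_false, not_false_eq_true, if_true]
  rw [e2]
  have m2 : MeasurableSet {p : ℝ × ℝ | w.dSq < p.2} :=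
    measurableSet_lt measurable_const measurable_snd
  have m3 : MeasurableSet {p : ℝ × ℝ | w.h < p.1} :=
    measurableSet_lt measurable_const measurable_fst
  refine Measurable.ite m1 measurable_const (Measurable.ite m2 (Measurable.ite m3 ?_ ?_)
    (Measurable.ite m3 ?_ ?_)) <;> fun_prop

theorem measurable_axialRoot : Measurable w.axialRoot := by
  unfold axialRoot
  exact Measurable.ite measurableSet_Iic (by fun_prop) (by fun_prop)

theorem measurable_modeKernel_uncurry (j : Parity) :
    Measurable fun X : ((ℝ × ℝ) × (ℝ × ℝ)) × ℝ => w.modeKernel j X.1.1 X.1.2 X.2 := by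
  have h1 := w.measurable_axialRoot
  have h2 : Measurable fun X : ((ℝ × ℝ) × (ℝ × ℝ)) × ℝ => w.v j X.1.1.1 X.2 :=
    (w.measurable_v j).comp (measurable_fst.fst.fst.prodMk measurable_snd)
  have h3 : Measurable fun X : ((ℝ × ℝ) × (ℝ × ℝ)) × ℝ => w.v j X.1.2.1 X.2 :=
    (w.measurable_v j).comp (measurable_fst.snd.fst.prodMk measurable_snd)
  unfold modeKernel
  have h4 : Measurable fun X : ((ℝ × ℝ) × (ℝ × ℝ)) × ℝ => w.axialRoot X.2 :=
    h1.comp measurable_snd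
  have h5 : Measurable fun X : ((ℝ × ℝ) × (ℝ × ℝ)) × ℝ => |X.1.1.2 - X.1.2.2| := by fun_prop
  fun_prop

theorem measurable_modeKernel (j : Parity) (p p' : ℝ × ℝ) : Measurable (w.modeKernel j p p') :=
  Measurable.of_uncurry_left (f := fun (P : (ℝ × ℝ) × (ℝ × ℝ)) lam => w.modeKernel j P.1 P.2 lam)
    (x := (p, p')) (w.measurable_modeKernel_uncurry j)

/-! ### Integration against the spectral measure -/

theorem r_nonneg (j : Parity) (lam : ℝ) : 0 ≤ w.r j lam :=
  inv_nonneg.2 (integral_nonneg fun _ => sq_nonneg _)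

theorem rho_eq (j : Parity) : w.rho j =
    ∑ lam ∈ (w.finite_guidedEigenvalues j).toFinset,
      ENNReal.ofReal (w.r j lam) • Measure.dirac lam +
    (volume.restrict (Set.Ioi w.dSq)).withDensity
      (fun lam => ENNReal.ofReal (w.sigma j lam / (2 * Real.pi))) := by
  have : Fintype (w.guidedEigenvalues j) := (w.finite_guidedEigenvalues j).fintype
  rw [rho, Measure.sum_fintype]
  congr 1
  exact (Finset.sum_subtype _ (fun x => (w.finite_guidedEigenvalues j).mem_toFinset)
    (fun lam => ENNReal.ofReal (w.r j lam) • Measure.dirac lam)).symm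

/-- Integrability with respect to `ρ_j` only has to be checked on the continuous spectrum. -/
theorem integrable_and_integral_rho (j : Parity) {f : ℝ → ℂ}
    (hf : IntegrableOn (fun lam => (w.sigma j lam / (2 * Real.pi)) • f lam) (Set.Ioi w.dSq)) :
    Integrable f (w.rho j) ∧ ∫ lam, f lam ∂(w.rho j) =
      ∑ lam ∈ (w.finite_guidedEigenvalues j).toFinset, w.r j lam • f lam +
        ∫ lam in Set.Ioi w.dSq, (w.sigma j lam / (2 * Real.pi)) • f lam := by
  have hm : Measurable fun lam => ENNReal.ofReal (w.sigma j lam / (2 * Real.pi)) :=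
    ((w.measurable_sigma j).div_const _).ennreal_ofReal
  have hlt : ∀ᵐ lam ∂(volume.restrict (Set.Ioi w.dSq)),
      ENNReal.ofReal (w.sigma j lam / (2 * Real.pi)) < ⊤ :=
    Filter.Eventually.of_forall fun _ => ENNReal.ofReal_lt_top
  have hcongr : ∀ lam ∈ Set.Ioi w.dSq,
      (ENNReal.ofReal (w.sigma j lam / (2 * Real.pi))).toReal • f lam =
        (w.sigma j lam / (2 * Real.pi)) • f lam := fun lam hlam => by
    rw [ENNReal.toReal_ofReal (div_nonneg (w.sigma_nonneg j hlam) (by positivity))]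
  have h1 : Integrable f ((volume.restrict (Set.Ioi w.dSq)).withDensity
      (fun lam => ENNReal.ofReal (w.sigma j lam / (2 * Real.pi)))) :=
    (integrable_withDensity_iff_integrable_smul' hm hlt).2
      (hf.congr_fun (fun lam hlam => (hcongr lam hlam).symm) measurableSet_Ioi)
  have h2 : ∀ lam ∈ (w.finite_guidedEigenvalues j).toFinset,
      Integrable f (ENNReal.ofReal (w.r j lam) • Measure.dirac lam) := fun lam _ =>
    (integrable_dirac (by simp)).smul_measure ENNReal.ofReal_ne_top
  have h3 := integrable_finsetSum_measure.2 h2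
  rw [w.rho_eq j]
  refine ⟨h3.add_measure h1, ?_⟩
  rw [integral_add_measure h3 h1, integral_finsetSum_measure h2,
    integral_withDensity_eq_integral_toReal_smul hm hlt]
  congr 1
  · refine Finset.sum_congr rfl fun lam _ => ?_
    rw [integral_smul_measure, integral_dirac, ENNReal.toReal_ofReal (w.r_nonneg j lam)]
  · exact setIntegral_congr_fun measurableSet_Ioi hcongr

theorem norm_sigma_smul (j : Parity) (f : ℝ → ℂ) {lam : ℝ} (hlam : w.dSq < lam) :
    ‖(w.sigma j lam / (2 * Real.pi)) • f lam‖ = ‖f lam‖ * w.sigma j lam / (2 * Real.pi) := by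
  rw [norm_smul, Real.norm_of_nonneg (div_nonneg (w.sigma_nonneg j hlam) (by positivity))]
  ring

theorem integrableOn_sigma_smul_modeKernel (j : Parity) {p p' : ℝ × ℝ} (hp : p.2 ≠ p'.2) :
    IntegrableOn (fun lam => (w.sigma j lam / (2 * Real.pi)) • w.modeKernel j p p' lam)
      (Set.Ioi w.dSq) := by
  obtain ⟨C, -, hC⟩ := w.exists_norm_modeKernel_mul_sigma_le j
  refine Integrable.mono' ((w.integrableOn_majorant.const_mul
    (C * (1 + |p.2 - p'.2| ^ (-(1 / 4) : ℝ)))).div_const (2 * Real.pi)) ?_ ?_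
  · exact (((w.measurable_sigma j).div_const _).smul
      (w.measurable_modeKernel j p p')).aestronglyMeasurable
  · refine (ae_restrict_iff' measurableSet_Ioi).2 (Filter.Eventually.of_forall fun lam hlam => ?_)
    rw [w.norm_sigma_smul j _ hlam]
    exact div_le_div_of_nonneg_right (hC p p' hp lam hlam) (by positivity)

theorem integrable_modeKernel (j : Parity) {p p' : ℝ × ℝ} (hp : p.2 ≠ p'.2) :
    Integrable (w.modeKernel j p p') (w.rho j) :=
  (w.integrable_and_integral_rho j (w.integrableOn_sigma_smul_modeKernel j hp)).1

theorem exists_norm_integral_modeKernel_le (j : Parity) : ∃ C : ℝ, 0 ≤ C ∧ ∀ p p' : ℝ × ℝ,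
    p.2 ≠ p'.2 → ‖∫ lam, w.modeKernel j p p' lam ∂(w.rho j)‖ ≤
      C * (1 + |p.2 - p'.2| ^ (-(1 / 4) : ℝ)) := by
  obtain ⟨C, hC0, hC⟩ := w.exists_norm_modeKernel_mul_sigma_le j
  choose! B hB using fun lam (hlam : lam ∈ w.guidedEigenvalues j) =>
    w.exists_norm_modeKernel_le j hlam.2.1.le
  set J := ∫ lam in Set.Ioi w.dSq, w.majorant lam
  have hJ : 0 ≤ J := setIntegral_nonneg measurableSet_Ioi fun lam hlam => w.majorant_nonneg hlam
  set S := ∑ lam ∈ (w.finite_guidedEigenvalues j).toFinset, w.r j lam * B lam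
  have hS : 0 ≤ S := Finset.sum_nonneg fun lam hlam => mul_nonneg (w.r_nonneg j lam)
    ((norm_nonneg _).trans (hB lam ((w.finite_guidedEigenvalues j).mem_toFinset.1 hlam) 0 0))
  refine ⟨S + C * J / (2 * Real.pi), by positivity, fun p p' hp => ?_⟩
  rw [(w.integrable_and_integral_rho j (w.integrableOn_sigma_smul_modeKernel j hp)).2]
  have hT : 0 ≤ |p.2 - p'.2| ^ (-(1 / 4) : ℝ) := by positivity
  set T := |p.2 - p'.2| ^ (-(1 / 4) : ℝ) with hTdef
  have h1 : ‖∑ lam ∈ (w.finite_guidedEigenvalues j).toFinset,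
      w.r j lam • w.modeKernel j p p' lam‖ ≤ S := by
    refine norm_sum_le_of_le _ fun lam hlam => ?_
    rw [norm_smul, Real.norm_of_nonneg (w.r_nonneg j lam)]
    exact mul_le_mul_of_nonneg_left
      (hB lam ((w.finite_guidedEigenvalues j).mem_toFinset.1 hlam) p p') (w.r_nonneg j lam)
  have h2 : ‖∫ lam in Set.Ioi w.dSq, (w.sigma j lam / (2 * Real.pi)) • w.modeKernel j p p' lam‖ ≤
      C * (1 + T) * J / (2 * Real.pi) := by
    rw [← integral_const_mul, ← integral_div]
    refine norm_integral_le_of_norm_le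
      ((w.integrableOn_majorant.const_mul (C * (1 + T))).div_const (2 * Real.pi)) ?_
    refine (ae_restrict_iff' measurableSet_Ioi).2 (Filter.Eventually.of_forall fun lam hlam => ?_)
    rw [w.norm_sigma_smul j _ hlam]
    exact div_le_div_of_nonneg_right (hC p p' hp lam hlam) (by positivity)
  refine (norm_add_le _ _).trans ((add_le_add h1 h2).trans ?_)
  have h3 : (S + C * J / (2 * Real.pi)) * (1 + T) = S + C * (1 + T) * J / (2 * Real.pi) + S * T := by
    ring
  rw [h3]
  exact le_add_of_nonneg_right (mul_nonneg hS hT)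

/-- The singularity of the Green's function at `z = ζ` is at most a small power of `|z - ζ|`,
uniformly in the transversal variables. -/
theorem exists_norm_green_le : ∃ C : ℝ, 0 < C ∧ ∀ p p' : ℝ × ℝ, p.2 ≠ p'.2 →
    ‖w.green p p'‖ ≤ C * (1 + |p.2 - p'.2| ^ (-(1 / 4) : ℝ)) := by
  obtain ⟨C₁, h₁, hC₁⟩ := w.exists_norm_integral_modeKernel_le .s
  obtain ⟨C₂, h₂, hC₂⟩ := w.exists_norm_integral_modeKernel_le .a
  refine ⟨C₁ + C₂ + 1, by positivity, fun p p' hp => ?_⟩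
  have hT : 0 ≤ |p.2 - p'.2| ^ (-(1 / 4) : ℝ) := by positivity
  have := (norm_add_le _ _).trans (add_le_add (hC₁ p p' hp) (hC₂ p p' hp))
  refine this.trans ?_
  linarith

/-! ### Guided, radiation and evanescent parts -/

theorem integral_modeKernel_eq (j : Parity) {p p' : ℝ × ℝ} (hp : p.2 ≠ p'.2) :
    ∫ lam, w.modeKernel j p p' lam ∂(w.rho j) = w.guidedTerm j p p' +
      1 / (2 * Real.pi) * w.radiationTerm j p p' +
        ((-(1 / (2 * Real.pi)) * w.evanescentTerm j p p' : ℝ) : ℂ) := by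
  have hd := w.dSq_lt_kappaSq
  have hi := w.integrableOn_sigma_smul_modeKernel j hp
  rw [(w.integrable_and_integral_rho j hi).2, ← Set.Ioc_union_Ioi_eq_Ioi hd.le,
    setIntegral_union (Set.Ioc_disjoint_Ioi le_rfl) measurableSet_Ioi
      (hi.mono_set Set.Ioc_subset_Ioi_self) (hi.mono_set (Set.Ioi_subset_Ioi hd.le)),
    integral_Ioc_eq_integral_Ioo, ← add_assoc]
  congr 1
  · congr 1
    · rw [guidedTerm, finsum_mem_eq_finite_toFinset_sum _ (w.finite_guidedEigenvalues j)]
      refine Finset.sum_congr rfl fun lam hlam => ?_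
      have hlam' := ((w.finite_guidedEigenvalues j).mem_toFinset.1 hlam).2.1
      rw [modeKernel, axialRoot, if_pos (hlam'.trans hd).le, Complex.real_smul, mul_comm]
    · rw [radiationTerm, ← integral_const_mul]
      refine setIntegral_congr_fun measurableSet_Ioo fun lam hlam => ?_
      simp only [modeKernel, axialRoot, if_pos hlam.2.le, Complex.real_smul]
      push_cast
      ring
  · rw [evanescentTerm, ← integral_const_mul, ← integral_complex_ofReal]
    refine setIntegral_congr_fun measurableSet_Ioi fun lam hlam => ?_
    have hlam' : w.kappaSq < lam := hlam
    have h1 : Complex.I * (|p.2 - p'.2| : ℝ) * (Complex.I * (√(lam - w.kappaSq) : ℂ)) =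
        ((-|p.2 - p'.2| * √(lam - w.kappaSq) : ℝ) : ℂ) := by
      push_cast
      linear_combination ((|p.2 - p'.2| : ℝ) : ℂ) * (√(lam - w.kappaSq) : ℂ) * Complex.I_mul_I
    have h2 : 2 * Complex.I * (Complex.I * (√(lam - w.kappaSq) : ℂ)) =
        -(2 * (√(lam - w.kappaSq) : ℂ)) := by
      linear_combination 2 * (√(lam - w.kappaSq) : ℂ) * Complex.I_mul_I
    simp only [modeKernel, axialRoot, if_neg (not_le.2 hlam'), Complex.real_smul, h1, h2]
    push_cast
    ring

theorem green_eq {p p' : ℝ × ℝ} (hp : p.2 ≠ p'.2) :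
    w.green p p' = w.greenGuided p p' + w.greenRadiation p p' + w.greenEvanescent p p' := by
  rw [green, w.integral_modeKernel_eq .s hp, w.integral_modeKernel_eq .a hp, greenGuided,
    greenRadiation, greenEvanescent]
  push_cast
  ring

theorem stronglyMeasurable_green :
    StronglyMeasurable fun P : (ℝ × ℝ) × (ℝ × ℝ) => w.green P.1 P.2 := by
  have h : ∀ j, StronglyMeasurable fun P : (ℝ × ℝ) × (ℝ × ℝ) =>
      ∫ lam, w.modeKernel j P.1 P.2 lam ∂(w.rho j) := fun j => by
    have : SFinite (w.rho j) := by
      have := (w.finite_guidedEigenvalues j).countable.to_subtype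
      unfold rho
      infer_instance
    exact StronglyMeasurable.integral_prod_right
      (f := fun (P : (ℝ × ℝ) × (ℝ × ℝ)) lam => w.modeKernel j P.1 P.2 lam)
      (w.measurable_modeKernel_uncurry j).stronglyMeasurable
  exact (h .s).add (h .a)

end Waveguide

/-! ### Integrability with respect to the weight -/

/-- `|t|^{-1/2}` is integrable on `[-1, 1]`. -/
theorem lintegral_indicator_rpow_enorm_lt_top :
    ∫⁻ t : ℝ, (Set.Icc (-1) 1).indicator (fun t => ‖t‖ₑ ^ (-(1 / 2) : ℝ)) t < ⊤ := by
  have h1 : IntegrableOn (fun y : ℝ => y ^ (-(1 / 2) : ℝ)) (Set.Ioc 0 1) :=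
    (intervalIntegral.intervalIntegrable_rpow' (a := 0) (b := 1) (by norm_num)).1
  have h2 : Integrable (fun t : ℝ => (Set.Ioc (0 : ℝ) 1).indicator
      (fun y : ℝ => y ^ (-(1 / 2) : ℝ)) ‖t‖) := by
    rw [integrable_fun_norm_addHaar volume
      (f := (Set.Ioc (0 : ℝ) 1).indicator (fun y : ℝ => y ^ (-(1 / 2) : ℝ)))]
    simpa using ((integrable_indicator_iff measurableSet_Ioc).2 h1).integrableOn
  refine lt_of_le_of_lt (lintegral_mono_ae ?_) h2.2
  filter_upwards [Measure.ae_ne volume (0 : ℝ)] with t ht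
  by_cases h : t ∈ Set.Icc (-1 : ℝ) 1
  · have h3 : ‖t‖ ∈ Set.Ioc (0 : ℝ) 1 := ⟨norm_pos_iff.2 ht, abs_le.2 h⟩
    rw [Set.indicator_of_mem h, Set.indicator_of_mem h3,
      Real.enorm_eq_ofReal (Real.rpow_nonneg h3.1.le _), ← ENNReal.ofReal_rpow_of_pos h3.1,
      ofReal_norm]
  · rw [Set.indicator_of_notMem h]
    exact zero_le

/-- An integrable bounded weight integrates the singularity `|z - ζ|^{-1/2}` uniformly in `z`. -/
theorem exists_lintegral_mul_one_add_rpow_le {f : ℝ → ℝ} (hf : Integrable f) (hf' : MemLp f ⊤) :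
    ∃ N : ENNReal, N ≠ ⊤ ∧
      ∀ z, ∫⁻ ζ, ‖f ζ‖ₑ * (1 + ‖z - ζ‖ₑ ^ (-(1 / 2) : ℝ)) ≤ N := by
  set g : ℝ → ENNReal := (Set.Icc (-1) 1).indicator (fun t => ‖t‖ₑ ^ (-(1 / 2) : ℝ)) with hg
  set M := eLpNorm f ⊤ volume
  have hM : M ≠ ⊤ := hf'.2.ne
  have hgm : Measurable g := Measurable.indicator (by fun_prop) measurableSet_Icc
  refine ⟨2 * (∫⁻ ζ, ‖f ζ‖ₑ) + M * ∫⁻ t, g t, ?_, fun z => ?_⟩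
  · exact ENNReal.add_ne_top.2 ⟨ENNReal.mul_ne_top (by simp) hf.2.ne,
      ENNReal.mul_ne_top hM lintegral_indicator_rpow_enorm_lt_top.ne⟩
  have hae : ∀ᵐ ζ, ‖f ζ‖ₑ ≤ M := by
    have := ae_le_eLpNormEssSup (f := f) (μ := volume)
    rwa [← eLpNorm_exponent_top] at this
  calc ∫⁻ ζ, ‖f ζ‖ₑ * (1 + ‖z - ζ‖ₑ ^ (-(1 / 2) : ℝ))
      ≤ ∫⁻ ζ, (2 * ‖f ζ‖ₑ + M * g (z - ζ)) := by
        refine lintegral_mono_ae ?_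
        filter_upwards [hae] with ζ hζ
        by_cases h : z - ζ ∈ Set.Icc (-1 : ℝ) 1
        · rw [hg, Set.indicator_of_mem h, mul_add, mul_one, two_mul]
          exact add_le_add le_self_add (mul_le_mul_left hζ _)
        · rw [hg, Set.indicator_of_notMem h, mul_zero, add_zero, mul_comm]
          refine mul_le_mul_left ?_ _
          have h1 : 1 ≤ ‖z - ζ‖ₑ := by
            rw [Real.enorm_eq_ofReal_abs]
            exact ENNReal.one_le_ofReal.2 (not_le.1 fun h' => h (abs_le.1 h')).le
          exact (add_le_add le_rfl (ENNReal.rpow_le_one_of_one_le_of_neg h1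
            (by norm_num : (-(1 / 2) : ℝ) < 0))).trans_eq one_add_one_eq_two
    _ = 2 * (∫⁻ ζ, ‖f ζ‖ₑ) + M * ∫⁻ t, g t := by
        rw [lintegral_add_right _ (by fun_prop), lintegral_const_mul' _ _ (by simp),
          lintegral_const_mul' _ _ hM, lintegral_sub_left_eq_self]

/-- A function of `(x, z)` and `(ξ, ζ)` with a singularity of order `|z - ζ|^{-1/4}` has finite norm
in `L²(μ × μ)`. Measurability of the function is not needed: an integral over a product is at most
the iterated integral. -/
theorem weightedL2Norm_lt_top_of_le {μ : ℝ × ℝ → ℝ} {μ₁ μ₂ : ℝ → ℝ} (hμpos : ∀ p, 0 < μ p)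
    (hμ : ∀ x z, μ (x, z) = μ₁ x * μ₂ z) (hμ₁ : Integrable μ₁)
    (hμ₂ : Integrable μ₂) (hμ₂' : MemLp μ₂ ⊤) {G : (ℝ × ℝ) × (ℝ × ℝ) → ℂ} {C : ℝ} (hC : 0 < C)
    (hG : ∀ p p' : ℝ × ℝ, p.2 ≠ p'.2 → ‖G (p, p')‖ ≤ C * (1 + |p.2 - p'.2| ^ (-(1 / 4) : ℝ))) :
    weightedL2Norm (fun P : (ℝ × ℝ) × (ℝ × ℝ) => μ P.1 * μ P.2) G < ⊤ := by
  obtain ⟨N, hN, hNle⟩ := exists_lintegral_mul_one_add_rpow_le hμ₂ hμ₂'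
  have hpt : ∀ p p' : ℝ × ℝ, ‖((√(μ p * μ p') : ℝ) : ℂ) * G (p, p')‖ₑ ^ (2 : ℝ) ≤
      ENNReal.ofReal (2 * C ^ 2) * ((‖μ₁ p.1‖ₑ * ‖μ₂ p.2‖ₑ) *
        (‖μ₁ p'.1‖ₑ * (‖μ₂ p'.2‖ₑ * (1 + ‖p.2 - p'.2‖ₑ ^ (-(1 / 2) : ℝ))))) := by
    intro p p'
    -- `μ₁` and `μ₂` may both be negative, only their product is positive
    have e : ∀ p : ℝ × ℝ, ‖μ₁ p.1‖ₑ * ‖μ₂ p.2‖ₑ = ENNReal.ofReal (μ p) := fun p => by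
      rw [← enorm_mul, ← hμ p.1 p.2, Real.enorm_eq_ofReal (hμpos _).le]
    rw [← mul_assoc ‖μ₁ p'.1‖ₑ, e, e]
    by_cases hp : p.2 = p'.2
    · -- here `‖z - ζ‖ₑ ^ (-1/2) = ⊤`, so nothing is claimed about `G`
      have h1 : ENNReal.ofReal (μ p) ≠ 0 := (ENNReal.ofReal_pos.2 (hμpos p)).ne'
      have h2 : ENNReal.ofReal (μ p') ≠ 0 := (ENNReal.ofReal_pos.2 (hμpos p')).ne'
      have h3 : ENNReal.ofReal (2 * C ^ 2) ≠ 0 := (ENNReal.ofReal_pos.2 (by positivity)).ne'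
      have h4 : (‖p.2 - p'.2‖ₑ : ENNReal) ^ (-(1 / 2) : ℝ) = ⊤ := by
        rw [hp, sub_self, enorm_zero, ENNReal.zero_rpow_of_neg (by norm_num)]
      rw [h4, add_top, ENNReal.mul_top h2, ENNReal.mul_top h1, ENNReal.mul_top h3]
      exact le_top
    · have ht : 0 < |p.2 - p'.2| := abs_pos.2 (sub_ne_zero.2 hp)
      have hG' := hG p p' hp
      have hT2 : (|p.2 - p'.2| ^ (-(1 / 4) : ℝ)) ^ 2 = |p.2 - p'.2| ^ (-(1 / 2) : ℝ) := by
        rw [← Real.rpow_mul_natCast ht.le]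
        norm_num
      have hk : 1 + ‖p.2 - p'.2‖ₑ ^ (-(1 / 2) : ℝ) =
          ENNReal.ofReal (1 + |p.2 - p'.2| ^ (-(1 / 2) : ℝ)) := by
        rw [Real.enorm_eq_ofReal_abs, ENNReal.ofReal_rpow_of_pos ht,
          ENNReal.ofReal_add zero_le_one (by positivity), ENNReal.ofReal_one]
      have hμμ : 0 ≤ μ p * μ p' := (mul_pos (hμpos p) (hμpos p')).le
      rw [hk, ← ENNReal.ofReal_mul (hμpos p').le, ← ENNReal.ofReal_mul (hμpos p).le,
        ← ENNReal.ofReal_mul (by positivity), ← ofReal_norm,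
        ENNReal.ofReal_rpow_of_nonneg (norm_nonneg _) (by norm_num)]
      refine ENNReal.ofReal_le_ofReal ?_
      rw [Real.rpow_two, norm_mul, mul_pow, Complex.norm_real, Real.norm_eq_abs, sq_abs,
        Real.sq_sqrt hμμ]
      have h5 : ‖G (p, p')‖ ^ 2 ≤ (C * (1 + |p.2 - p'.2| ^ (-(1 / 4) : ℝ))) ^ 2 :=
        pow_le_pow_left₀ (norm_nonneg _) hG' 2
      rw [← hT2]
      set T := |p.2 - p'.2| ^ (-(1 / 4) : ℝ)
      have h6 : (C * (1 + T)) ^ 2 ≤ 2 * C ^ 2 * (1 + T ^ 2) := by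
        nlinarith [mul_nonneg (sq_nonneg C) (sq_nonneg (1 - T))]
      calc μ p * μ p' * ‖G (p, p')‖ ^ 2 ≤ μ p * μ p' * (2 * C ^ 2 * (1 + T ^ 2)) :=
            mul_le_mul_of_nonneg_left (h5.trans h6) hμμ
        _ = 2 * C ^ 2 * (μ p * (μ p' * (1 + T ^ 2))) := by ring
  have hA : ∫⁻ x, ‖μ₁ x‖ₑ ≠ ⊤ := hμ₁.2.ne
  have hB : ∫⁻ z, ‖μ₂ z‖ₑ ≠ ⊤ := hμ₂.2.ne
  set A := ∫⁻ x, ‖μ₁ x‖ₑ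
  set B := ∫⁻ z, ‖μ₂ z‖ₑ
  have hin : ∀ z, ∫⁻ p' : ℝ × ℝ,
      ‖μ₁ p'.1‖ₑ * (‖μ₂ p'.2‖ₑ * (1 + ‖z - p'.2‖ₑ ^ (-(1 / 2) : ℝ))) ≤ A * N := by
    intro z
    rw [Measure.volume_eq_prod]
    refine (lintegral_prod_le _).trans ?_
    rw [← lintegral_mul_const' _ _ hN]
    refine lintegral_mono fun ξ => ?_
    dsimp only
    rw [lintegral_const_mul' _ _ enorm_ne_top]
    gcongr
    exact hNle z
  rw [weightedL2Norm, eLpNorm_lt_top_iff_lintegral_rpow_enorm_lt_top (by simp) (by simp),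
    ENNReal.toReal_ofNat]
  have hAB : ∫⁻ p : ℝ × ℝ, ‖μ₁ p.1‖ₑ * ‖μ₂ p.2‖ₑ ≤ A * B := by
    rw [Measure.volume_eq_prod]
    refine (lintegral_prod_le _).trans ?_
    rw [← lintegral_mul_const' _ _ hB]
    refine lintegral_mono fun x => ?_
    dsimp only
    rw [lintegral_const_mul' _ _ enorm_ne_top]
  calc ∫⁻ P : (ℝ × ℝ) × (ℝ × ℝ), ‖((√(μ P.1 * μ P.2) : ℝ) : ℂ) * G P‖ₑ ^ (2 : ℝ)
      ≤ ∫⁻ P : (ℝ × ℝ) × (ℝ × ℝ), ENNReal.ofReal (2 * C ^ 2) * ((‖μ₁ P.1.1‖ₑ * ‖μ₂ P.1.2‖ₑ) *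
        (‖μ₁ P.2.1‖ₑ * (‖μ₂ P.2.2‖ₑ * (1 + ‖P.1.2 - P.2.2‖ₑ ^ (-(1 / 2) : ℝ))))) :=
        lintegral_mono fun P => hpt P.1 P.2
    _ = ENNReal.ofReal (2 * C ^ 2) * ∫⁻ P : (ℝ × ℝ) × (ℝ × ℝ), ((‖μ₁ P.1.1‖ₑ * ‖μ₂ P.1.2‖ₑ) *
        (‖μ₁ P.2.1‖ₑ * (‖μ₂ P.2.2‖ₑ * (1 + ‖P.1.2 - P.2.2‖ₑ ^ (-(1 / 2) : ℝ))))) :=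
        lintegral_const_mul' _ _ ENNReal.ofReal_ne_top
    _ ≤ ENNReal.ofReal (2 * C ^ 2) * (A * B * (A * N)) := by
        gcongr
        rw [Measure.volume_eq_prod]
        refine (lintegral_prod_le _).trans ?_
        refine le_trans (lintegral_mono fun p => ?_)
          ((lintegral_mul_const' (A * N) (fun p : ℝ × ℝ => ‖μ₁ p.1‖ₑ * ‖μ₂ p.2‖ₑ)
            (ENNReal.mul_ne_top hA hN)).le.trans (mul_le_mul_left hAB _))
        dsimp only
        rw [lintegral_const_mul' _ _ (ENNReal.mul_ne_top enorm_ne_top enorm_ne_top)]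
        gcongr
        exact hin p.2
    _ < ⊤ := by
        refine ENNReal.mul_lt_top ENNReal.ofReal_lt_top (ENNReal.mul_lt_top ?_ ?_)
        · exact ENNReal.mul_lt_top hA.lt_top hB.lt_top
        · exact ENNReal.mul_lt_top hA.lt_top hN.lt_top

end OpenWaveguide

theorem mainTheorem3 (w : OpenWaveguide.Waveguide) (μ : ℝ × ℝ → ℝ) (μ₁ μ₂ : ℝ → ℝ)
    (hμpos : ∀ p, 0 < μ p)
    (hμ : ∀ x z, μ (x, z) = μ₁ x * μ₂ z)
    (hμ₁ : Integrable μ₁) (hμ₁' : MemLp μ₁ ⊤)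
    (hμ₂ : Integrable μ₂) (hμ₂' : MemLp μ₂ ⊤) :
    -- there are finitely many guided modes
    (∀ j, (w.guidedEigenvalues j).Finite) ∧
    -- the spectral integrals converge absolutely off the null set `z = ζ`
    (∀ j, ∀ p p' : ℝ × ℝ, p.2 ≠ p'.2 → Integrable (w.modeKernel j p p') (w.rho j)) ∧
    -- `G = G^g + G^r + G^e`
    (∀ p p' : ℝ × ℝ, p.2 ≠ p'.2 →
      w.green p p' = w.greenGuided p p' + w.greenRadiation p p' + w.greenEvanescent p p') ∧
    -- `G` is a measurable function with finite norm in `L²(μ × μ)`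
    AEStronglyMeasurable (fun P : (ℝ × ℝ) × (ℝ × ℝ) => w.green P.1 P.2) volume ∧
    OpenWaveguide.weightedL2Norm (fun P : (ℝ × ℝ) × (ℝ × ℝ) => μ P.1 * μ P.2)
      (fun P => w.green P.1 P.2) < ⊤ := by
  obtain ⟨C, hC, hG⟩ := w.exists_norm_green_le
  exact ⟨w.finite_guidedEigenvalues, fun j p p' hp => w.integrable_modeKernel j hp,
    fun p p' hp => w.green_eq hp, w.stronglyMeasurable_green.aestronglyMeasurable,
    OpenWaveguide.weightedL2Norm_lt_top_of_le hμpos hμ hμ₁ hμ₂ hμ₂' hC hG⟩
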